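/- **Definitions.** Let $(X,d)$ be a metric space and $\mu:X^3\to X$ a map; write $\mu_{\mathbb R}$ for the usual median of three real numbers. * A *median algebra* is a set $Q$ with a symmetric ternary operation $m$ such that $m(x,x,y)=x$ and $m(a,b,m(x,y,z))=m(m(a,b,x),m(a,b,y),z)$; its *rank* is the supremum of the $n\in\mathbb N$ for which there is an injective median homomorphism $\{0,1\}^n\to Q$. * $(X,\mu,d)$ is a *coarse median space* if there is $h:\mathbb N\to(0,\infty)$ such that (i) $d(\mu(a,b,c),\mu(a',b',c'))\le h(0)\,(d(a,a')+d(b,b')+d(c,c'))+h(0)$ for all $a,b,c,a',b',c'\in X$; (ii) for each finite non-empty $A\subset X$ with $|A|\le n$ there are a finite median algebra $(Q,\mu_Q)$ and maps $\pi:A\to Q$, $\lambda:Q\to X$ with $d(\lambda\mu_Q(\alpha,\beta,\gamma),\mu(\lambda\alpha,\lambda\beta,\lambda\gamma))\le h(n)$ for all $\alpha,\beta,\gamma\in Q$ and $d(a,\lambda\pi a)\le h(n)$ for all $a\in A$. It has rank at most $\nu$ if $h$ and the algebras $Q$ can be chosen so that every $Q$ has rank at most $\nu$. * The *median interval* is $[a,b]=\{\mu(a,b,x):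 x\in X\}$. * $(X,\mu,d)$ has *quasicubical intervals* if there are $\nu\in\mathbb N$ and $\kappa\ge1$ such that it has rank at most $\nu$ and for all $a,b\in X$ there are a finite CAT(0) cube complex of dimension at most $\nu$, with vertex set $Q$, combinatorial ($\ell^1$) distance $d_Q$ and median $\mu_Q$ on $Q$ (equivalently, a finite median graph with its path metric and median, in which every induced hypercube has dimension at most $\nu$), and a map $\lambda:Q\to[a,b]$ such that every point of $[a,b]$ is within $\kappa$ of $\lambda(Q)$, $\frac1\kappa d_Q(\alpha,\beta)-\kappa\le d(\lambda\alpha,\lambda\beta)\le\kappa d_Q(\alpha,\beta)+\kappa$, and $d(\lambda\mu_Q(\alpha,\beta,\gamma),\mu(\lambda\alpha,\lambda\beta,\lambda\gamma))\le\kappa$ for all $\alpha,\beta,\gamma\in Q$. * A metric $\rho$ on $X$ is *roughly geodesic* if there is $C\ge0$ such that for all $a,b\in X$ there is $f:[0,\rho(a,b)]\to X$ with $f(0)=a$, $f(\rho(a,b))=b$ and $|s-t|-C\le\rho(f(s),f(t))\le|s-t|+C$ for all $s,t$. It is *weakly roughly geodesic* if there is $C\ge0$ such that for all $a,b\in X$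 and $0\le r\le\rho(a,b)$ there is $c\in X$ with $|\rho(a,c)-r|\le C$ and $\rho(a,c)+\rho(c,b)\le\rho(a,b)+C$. * For $K>0$, a *$K$-contraction* is a map $\Phi:X\to\mathbb R$ with $|\Phi(x)-\Phi(y)|\le d(x,y)+K$ and $|\Phi(\mu(x,y,z))-\mu_{\mathbb R}(\Phi(x),\Phi(y),\Phi(z))|\le K$ for all $x,y,z\in X$. Define $\sigma(a,b)$ as the supremum of all $r\ge0$ for which there is a $K$-contraction $\Phi$ with $\Phi(a)=0$ and $\Phi(b)=r$. **Theorem.** Let $(X,\mu,d)$ be a coarse median space with quasicubical intervals such that $d$ is roughly geodesic, and let $K>0$. Then $\sigma$ is a metric on $X$, and: 1. $\sigma$ and $d$ are quasi-isometric: there is $q\ge1$ with $\frac1q d(x,y)-q\le\sigma(x,y)\le q\,d(x,y)+q$ for all $x,y\in X$; 2. $\sigma$ is weakly roughly geodesic; 3. $\sigma$-balls are uniformly coarsely median-convex: there is $M\ge0$ such that for every open or closed $\sigma$-ball $B$, all $y,y'\in B$ and all $x\in X$, the point $\mu(x,y,y')$ is at distance at most $M$ from $B$, both for $d$ and for $\sigma$;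 4. $\sigma$ is invariant under median isometries: if $g:X\to X$ is a bijective $d$-isometry with $g\mu(x,y,z)=\mu(gx,gy,gz)$ for all $x,y,z\in X$, then $\sigma(gx,gy)=\sigma(x,y)$ for all $x,y\in X$. -/

import Mathlib

namespace CoarseMedian

/-! ### Median algebras -/

/-- `m` is a median on the set `Q`. -/
structure IsMedian {Q : Type*} (m : Q → Q → Q → Q) : Prop where
  swap_left : ∀ x y z, m x y z = m y x z
  swap_right : ∀ x y z, m x y z = m x z y
  localised : ∀ x y, m x x y = x
  assoc : ∀ a b x y z, m a b (m x y z) = m (m a b x) (m a b y) z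

/-- The median (majority vote in each coordinate) on the cube `{0,1}^n`. -/
def cubeMedian (n : ℕ) (x y z : Fin n → Bool) : Fin n → Bool :=
  fun i => (x i && y i) || (y i && z i) || (x i && z i)

/-- The rank of a median algebra: the supremum of all `n` such that the `n`-cube `{0,1}^n`
admits an injective median homomorphism to `Q`. -/
noncomputable def medianRank {Q : Type*} (m : Q → Q → Q → Q) : ℕ∞ :=
  ⨆ (n : ℕ) (_ : ∃ f : (Fin n → Bool) → Q, Function.Injective f ∧
    ∀ x y z, f (cubeMedian n x y z) = m (f x) (f y) (f z)), (n : ℕ∞)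

/-- The standard median on the real line. -/
noncomputable def realMedian (a b c : ℝ) : ℝ :=
  max (min a b) (min (max a b) c)

/-! ### Coarse median spaces -/

/-- `μ` is a coarse median on the metric space `X` with control function `h`, and the
approximating finite median algebras can be chosen of rank at most `ν`. -/
def IsCoarseMedianWith {X : Type*} [MetricSpace X] (μ : X → X → X → X)
    (h : ℕ → ℝ) (ν : ℕ∞) : Prop :=
  (∀ n, 0 < h n) ∧
  (∀ a b c a' b' c' : X,
    dist (μ a b c) (μ a' b' c') ≤ h 0 * (dist a a' + dist b b' + dist c c') + h 0) ∧
  ∀ (n : ℕ) (A : Finset X), A.Nonempty → A.card ≤ n →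
    ∃ (Q : Type) (_ : Finite Q) (m : Q → Q → Q → Q) (pr : A → Q) (lam : Q → X),
      IsMedian m ∧ medianRank m ≤ ν ∧
      (∀ α β γ : Q, dist (lam (m α β γ)) (μ (lam α) (lam β) (lam γ)) ≤ h n) ∧
      ∀ a : A, dist (a : X) (lam (pr a)) ≤ h n

/-- `(X, μ, d)` is a coarse median space. -/
def IsCoarseMedian {X : Type*} [MetricSpace X] (μ : X → X → X → X) : Prop :=
  ∃ h : ℕ → ℝ, IsCoarseMedianWith μ h ⊤

/-- The coarse median `μ` has rank at most `ν`. -/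
def HasRankAtMost {X : Type*} [MetricSpace X] (μ : X → X → X → X) (ν : ℕ) : Prop :=
  ∃ h : ℕ → ℝ, IsCoarseMedianWith μ h (ν : ℕ∞)

/-- The median interval `[a,b]`. -/
def interval {X : Type*} (μ : X → X → X → X) (a b : X) : Set X :=
  {p | ∃ x, p = μ a b x}

/-- A subset `Y` is `M`-coarsely median-convex, distances being measured by `ρ`:
`ρ(Y, μ(x,y,y')) ≤ M` for all `y, y' ∈ Y` and all `x`. -/
def IsCoarselyMedianConvex {X : Type*} (μ : X → X → X → X) (ρ : X → X → ℝ) (M : ℝ)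
    (Y : Set X) : Prop :=
  ∀ y ∈ Y, ∀ y' ∈ Y, ∀ x : X, (⨅ z : Y, ρ z (μ x y y')) ≤ M

/-! ### Finite CAT(0) cube complexes -/

/-- The 1-skeleton of the `n`-cube. -/
def cubeGraph (n : ℕ) : SimpleGraph (Fin n → Bool) :=
  SimpleGraph.fromRel fun x y => hammingDist x y = 1

/-- `m` lies on geodesics of `G` between each two of `x`, `y`, `z`. -/
def IsGraphMedian {V : Type*} (G : SimpleGraph V) (x y z m : V) : Prop :=
  G.dist x m + G.dist m y = G.dist x y ∧
  G.dist y m + G.dist m z = G.dist y z ∧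
  G.dist x m + G.dist m z = G.dist x z

/-- A finite CAT(0) cube complex, presented by its 1-skeleton. A finite connected graph is the
1-skeleton of a CAT(0) cube complex exactly when it is a median graph, and then the complex is
unique: its cubes are obtained by filling in all the induced subgraphs that are 1-skeleta of
cubes. -/
structure FiniteCAT0CubeComplex where
  V : Type
  finite : Finite V
  graph : SimpleGraph V
  connected : graph.Connected
  existsUnique_median : ∀ x y z : V, ∃! m : V, IsGraphMedian graph x y z m

namespace FiniteCAT0CubeComplex

/-- The (combinatorial) `ℓ¹` distance on the vertices. -/
noncomputable def l1dist (Q : FiniteCAT0CubeComplex) (x y : Q.V) : ℝ :=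
  (Q.graph.dist x y : ℝ)

/-- The median on the vertices. -/
noncomputable def median (Q : FiniteCAT0CubeComplex) (x y z : Q.V) : Q.V :=
  (Q.existsUnique_median x y z).choose

/-- The dimension: the supremum of the dimensions of the cubes of `Q`. -/
noncomputable def dim (Q : FiniteCAT0CubeComplex) : ℕ∞ :=
  ⨆ (n : ℕ) (_ : Nonempty (cubeGraph n ↪g Q.graph)), (n : ℕ∞)

end FiniteCAT0CubeComplex

/-- `(X, μ, d)` has quasicubical intervals. -/
def HasQuasicubicalIntervals {X : Type*} [MetricSpace X] (μ : X → X → X → X) : Prop :=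
  ∃ ν : ℕ, HasRankAtMost μ ν ∧ ∃ κ : ℝ, 1 ≤ κ ∧ ∀ a b : X,
    ∃ (Q : FiniteCAT0CubeComplex) (lam : Q.V → X),
      Q.dim ≤ (ν : ℕ∞) ∧
      (∀ α, lam α ∈ interval μ a b) ∧
      (∀ p ∈ interval μ a b, ∃ α, dist (lam α) p ≤ κ) ∧
      (∀ α β, 1 / κ * Q.l1dist α β - κ ≤ dist (lam α) (lam β) ∧
        dist (lam α) (lam β) ≤ κ * Q.l1dist α β + κ) ∧
      ∀ α β γ, dist (lam (Q.median α β γ)) (μ (lam α) (lam β) (lam γ)) ≤ κ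

/-! ### Properties of distance functions -/

/-- `ρ` is a metric on `X` (non-negativity follows from these axioms). -/
def IsMetric {X : Type*} (ρ : X → X → ℝ) : Prop :=
  (∀ x y, ρ x y = 0 ↔ x = y) ∧ (∀ x y, ρ x y = ρ y x) ∧
    ∀ x y z, ρ x z ≤ ρ x y + ρ y z

/-- Any two points are joined by a `(1,C)`-quasi-isometric embedding of a real interval of
length their distance, with `C` uniform. -/
def IsRoughlyGeodesic {X : Type*} (ρ : X → X → ℝ) : Prop :=
  ∃ C : ℝ, 0 ≤ C ∧ ∀ a b : X, ∃ f : ℝ → X,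
    f 0 = a ∧ f (ρ a b) = b ∧
    ∀ s ∈ Set.Icc (0 : ℝ) (ρ a b), ∀ t ∈ Set.Icc (0 : ℝ) (ρ a b),
      |s - t| - C ≤ ρ (f s) (f t) ∧ ρ (f s) (f t) ≤ |s - t| + C

def IsWeaklyRoughlyGeodesic {X : Type*} (ρ : X → X → ℝ) : Prop :=
  ∃ C : ℝ, 0 ≤ C ∧ ∀ (a b : X) (r : ℝ), 0 ≤ r → r ≤ ρ a b →
    ∃ c : X, |ρ a c - r| ≤ C ∧ ρ a c + ρ c b ≤ ρ a b + C

/-- Two metrics on the same set are quasi-isometric (through the identity map). -/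
def AreQuasiIsometric {X : Type*} (ρ ρ' : X → X → ℝ) : Prop :=
  ∃ q : ℝ, 1 ≤ q ∧ ∀ x y : X,
    1 / q * ρ x y - q ≤ ρ' x y ∧ ρ' x y ≤ q * ρ x y + q

/-- The closed ball of centre `w` and radius `R` for `ρ`. -/
def closedBall {X : Type*} (ρ : X → X → ℝ) (w : X) (R : ℝ) : Set X := {x | ρ w x ≤ R}

/-- The open ball of centre `w` and radius `R` for `ρ`. -/
def openBall {X : Type*} (ρ : X → X → ℝ) (w : X) (R : ℝ) : Set X := {x | ρ w x < R}

/-! ### The new metric -/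

/-- `Φ` is a `K`-contraction: `(1,K)`-coarsely Lipschitz and `K`-quasi-median. -/
def IsContraction {X : Type*} [MetricSpace X] (μ : X → X → X → X) (K : ℝ) (Φ : X → ℝ) : Prop :=
  (∀ x y : X, |Φ x - Φ y| ≤ dist x y + K) ∧
  ∀ a b c : X, |Φ (μ a b c) - realMedian (Φ a) (Φ b) (Φ c)| ≤ K

/-- The values `r ≥ 0` whose supremum is `σ(a,b)`. -/
def sigmaSet {X : Type*} [MetricSpace X] (μ : X → X → X → X) (K : ℝ) (a b : X) : Set ℝ :=
  {r | 0 ≤ r ∧ ∃ Φ : X → ℝ, IsContraction μ K Φ ∧ Φ a = 0 ∧ Φ b = r}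

/-- The new metric `σ = σ_K`. -/
noncomputable def sigma {X : Type*} [MetricSpace X] (μ : X → X → X → X) (K : ℝ) (a b : X) : ℝ :=
  sSup (sigmaSet μ K a b)

/-- The supremum defining `σ` is a genuine one. -/
theorem isLUB_sigma {X : Type*} [MetricSpace X] (μ : X → X → X → X) {K : ℝ} (hK : 0 ≤ K)
    (a b : X) : IsLUB (sigmaSet μ K a b) (sigma μ K a b) := by
  apply isLUB_csSup
  · refine ⟨0, le_refl _, fun _ => 0, ⟨fun x y => ?_, fun a b c => ?_⟩, rfl, rfl⟩
    · simpa using add_nonneg dist_nonneg hK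
    · simpa [realMedian] using hK
  · refine ⟨dist b a + K, ?_⟩
    rintro r ⟨_, Φ, hΦ, ha, hb⟩
    have h := hΦ.1 b a
    rw [ha, hb, sub_zero] at h
    exact (le_abs_self r).trans h

end CoarseMedian

/-! The value `σ(a,b)` is the largest increase `Φ b - Φ a` over `K`-contractions, so symmetry, the
triangle inequality and invariance under median isometries are formal; since `K > 0`, functions with
values in `[0,K]` separate points. The content lies in two facts.

Interpolation (`exists_interpolation`): if `σ(a,b) ≤ r + s`, some `c` has `σ(a,c) ≤ r + G` and
`σ(c,b) ≤ s + G`. Take contractions `Φ`, `Ψ` vanishing at `a`, `b` respectively. If `{Φ ≤ r +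
const}` and `{Ψ ≤ s + const}` were disjoint, `Φ` followed by `-Ψ` would glue to a contraction, with
the same `K`, that increases by more than `r + s` from `a` to `b` (`IsContraction.glue`). So these
sublevel sets meet; projecting to `[a,b]`, so do the corresponding ones in its cubical model. The
convex hulls of the latter have a common vertex by Helly, and passing to the hull raises a
quasi-median function by an amount that depends on the dimension but not on the set
(`le_of_mem_hull`). The image of that vertex is `c`. Weak rough geodesicity follows at once. So does
convexity of balls: a median of two points of an `R`-ball with any third point has `σ`-distance at
most `R + K` from the centre, and interpolation moves it back into the ball.

Comparison with `d`: the upper bound is built into contractions. For the lower bound, vertices at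
distance `D` in a cube complex of dimension `ν` are separated by a chain of at least `D / (ν + 1)`
halfspaces (`exists_chain`). Counting these is a 1-Lipschitz median homomorphism; composed with the
projection to `[a,b]` and rescaled, it is a contraction. -/

namespace CoarseMedian

/-! ### Median graphs -/

namespace FiniteCAT0CubeComplex

variable (Q : FiniteCAT0CubeComplex)

theorem dist_triangle (x y z : Q.V) :
    Q.graph.dist x z ≤ Q.graph.dist x y + Q.graph.dist y z :=
  Q.connected.dist_triangle

theorem dist_comm (x y : Q.V) : Q.graph.dist x y = Q.graph.dist y x :=
  SimpleGraph.dist_comm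

theorem isGraphMedian_median (x y z : Q.V) : IsGraphMedian Q.graph x y z (Q.median x y z) :=
  (Q.existsUnique_median x y z).choose_spec.1

theorem eq_median {x y z m : Q.V} (h : IsGraphMedian Q.graph x y z m) : m = Q.median x y z :=
  (Q.existsUnique_median x y z).unique h (Q.isGraphMedian_median x y z)

theorem median_swap_left (x y z : Q.V) : Q.median x y z = Q.median y x z := by
  apply Q.eq_median
  obtain ⟨h1, h2, h3⟩ := Q.isGraphMedian_median x y z
  refine ⟨?_, h3, h2⟩
  have := Q.dist_comm x y
  have := Q.dist_comm x (Q.median x y z)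
  have := Q.dist_comm y (Q.median x y z)
  omega

theorem median_swap_right (x y z : Q.V) : Q.median x y z = Q.median x z y := by
  apply Q.eq_median
  obtain ⟨h1, h2, h3⟩ := Q.isGraphMedian_median x y z
  refine ⟨h3, ?_, h1⟩
  have := Q.dist_comm z y
  have := Q.dist_comm z (Q.median x y z)
  have := Q.dist_comm y (Q.median x y z)
  omega

/-- Intervals of a median graph are gated. -/
theorem dist_gate {a b v : Q.V} (x : Q.V)
    (hv : Q.graph.dist a v + Q.graph.dist v b = Q.graph.dist a b) :
    Q.graph.dist x (Q.median a b x) + Q.graph.dist (Q.median a b x) v = Q.graph.dist x v := by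
  obtain ⟨s1, s2, s3⟩ := Q.isGraphMedian_median a x v
  obtain ⟨t1, t2, t3⟩ := Q.isGraphMedian_median b x v
  -- As `v ∈ [a,b]`, the path `a, s, v, t, b` is geodesic. Hence the median `h` of `s, t, x` lies in
  -- `[a,b]`, `[a,x]` and `[b,x]`, and by uniqueness it is the median of `a, b, x`.
  set s := Q.median a x v
  set t := Q.median b x v
  obtain ⟨h1, h2, h3⟩ := Q.isGraphMedian_median s t x
  set h := Q.median s t x
  have e1 := Q.dist_triangle a s t
  have e2 := Q.dist_triangle a t b
  have e3 := Q.dist_triangle s v t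
  have e4 := Q.dist_triangle a s h
  have e5 := Q.dist_triangle h t b
  have e6 := Q.dist_triangle a h b
  have e7 := Q.dist_triangle a h x
  have e8 := Q.dist_triangle b h x
  have e9 := Q.dist_triangle b t h
  have e10 := Q.dist_triangle x h v
  have e11 := Q.dist_triangle h s v
  have c1 := Q.dist_comm s x
  have c2 := Q.dist_comm t x
  have c3 := Q.dist_comm h x
  have c4 := Q.dist_comm t h
  have c5 := Q.dist_comm t b
  have c6 := Q.dist_comm t v
  have c7 := Q.dist_comm b v
  have c8 := Q.dist_comm b h
  have c9 := Q.dist_comm s h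
  have hh : h = Q.median a b x := Q.eq_median ⟨by omega, by omega, by omega⟩
  rw [← hh]
  omega

/-- Median-convex sets of vertices. -/
def IsConvex (C : Set Q.V) : Prop := ∀ x ∈ C, ∀ y ∈ C, ∀ z, Q.median x y z ∈ C

variable {Q}

theorem IsConvex.inter {A B : Set Q.V} (hA : Q.IsConvex A) (hB : Q.IsConvex B) :
    Q.IsConvex (A ∩ B) :=
  fun x hx y hy z => ⟨hA x hx.1 y hy.1 z, hB x hx.2 y hy.2 z⟩

theorem IsConvex.mem_of_between {C : Set Q.V} (hC : Q.IsConvex C) {x y u : Q.V} (hx : x ∈ C)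
    (hy : y ∈ C) (hu : Q.graph.dist x u + Q.graph.dist u y = Q.graph.dist x y) : u ∈ C := by
  have : u = Q.median x y u := by
    refine Q.eq_median ⟨hu, ?_, ?_⟩ <;> simp [SimpleGraph.dist_self]
  rw [this]
  exact hC x hx y hy u

/-! ### Halfspaces and intervals -/

variable (Q)

theorem isConvex_univ : Q.IsConvex Set.univ := fun _ _ _ _ _ => trivial

/-- The vertices closer to `q` than to `p`. -/
def side (q p : Q.V) : Set Q.V := {x | Q.graph.dist x q < Q.graph.dist x p}

variable {Q}

theorem mem_side {q p x : Q.V} : x ∈ Q.side q p ↔ Q.graph.dist x q < Q.graph.dist x p := Iff.rfl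

/-- Median graphs are bipartite: the median of `p, q, x` lies on the edge `pq`, so it is one of its
ends. -/
theorem dist_ne_dist_of_adj {p q : Q.V} (h : Q.graph.dist p q = 1) (x : Q.V) :
    Q.graph.dist x p ≠ Q.graph.dist x q := by
  obtain ⟨h1, h2, h3⟩ := Q.isGraphMedian_median p q x
  set m := Q.median p q x
  have c1 := Q.dist_comm p x
  have c2 := Q.dist_comm q x
  have c3 := Q.dist_comm m x
  have c4 := Q.dist_comm m q
  have c5 := Q.dist_comm m p
  omega

theorem notMem_side {q p x : Q.V} (h : Q.graph.dist p q = 1) :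
    x ∉ Q.side q p ↔ x ∈ Q.side p q := by
  have := dist_ne_dist_of_adj h x
  simp only [mem_side]
  omega

theorem dist_symm_one {p q : Q.V} (h : Q.graph.dist p q = 1) : Q.graph.dist q p = 1 := by
  rw [Q.dist_comm, h]

/-- If `x` and `y` are nearer to `q`, then `p` and `q` have the same gate in `[x,y]`, so every point
of `[x,y]` is one step nearer to `q` than to `p`. -/
theorem isConvex_side {q p : Q.V} (h : Q.graph.dist p q = 1) : Q.IsConvex (Q.side q p) := by
  intro x hx y hy z
  obtain ⟨u1, -, -⟩ := Q.isGraphMedian_median x y z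
  have g1 := Q.dist_gate p u1
  have g2 := Q.dist_gate q u1
  set u := Q.median x y z
  obtain ⟨w1, w2, w3⟩ := Q.isGraphMedian_median x y q
  rw [mem_side] at hx hy ⊢
  have c0 := Q.dist_comm p q
  have t1 := Q.dist_triangle x q p
  have t2 := Q.dist_triangle y q p
  have t3 := Q.dist_triangle (Q.median x y q) q p
  have t4 := Q.dist_triangle x (Q.median x y q) p
  have t5 := Q.dist_triangle y (Q.median x y q) p
  have hw : Q.median x y q = Q.median x y p :=
    Q.eq_median ⟨w1, by omega, by omega⟩
  rw [← hw] at g1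
  set w := Q.median x y q
  have c1 := Q.dist_comm p w
  have c2 := Q.dist_comm q w
  have c3 := Q.dist_comm p u
  have c4 := Q.dist_comm q u
  omega

theorem isConvex_compl_side {q p : Q.V} (h : Q.graph.dist p q = 1) :
    Q.IsConvex (Q.side q p)ᶜ := by
  have : (Q.side q p)ᶜ = Q.side p q := by
    ext x
    exact notMem_side h
  rw [this]
  exact isConvex_side (dist_symm_one h)

/-- A halfspace is determined by any edge that crosses it. -/
theorem eq_side_of_crossing {H : Set Q.V} (hH : Q.IsConvex H) (hH' : Q.IsConvex Hᶜ) {u v : Q.V}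
    (huv : Q.graph.dist u v = 1) (hu : u ∈ H) (hv : v ∉ H) : H = Q.side u v := by
  have hvu := dist_symm_one huv
  ext x
  by_cases hx : x ∈ Q.side u v
  · refine iff_of_true ?_ hx
    by_contra hxH
    refine hH'.mem_of_between hxH hv ?_ hu
    have := Q.dist_triangle x u v
    rw [mem_side] at hx
    omega
  · refine iff_of_false (fun hxH => ?_) hx
    rw [notMem_side hvu, mem_side] at hx
    refine hv (hH.mem_of_between hxH hu ?_)
    have := Q.dist_triangle x v u
    omega

/-- A point `u` between `x` and `y` equals its gate `w` in `[a,b]`: the detour through `w` would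
otherwise shorten `d(x,y)` by `2 d(u,w)`. -/
theorem isConvex_between (a b : Q.V) :
    Q.IsConvex {x | Q.graph.dist a x + Q.graph.dist x b = Q.graph.dist a b} := by
  intro x hx y hy z
  obtain ⟨h1, -, -⟩ := Q.isGraphMedian_median x y z
  set u := Q.median x y z
  have g := Q.dist_gate u hx
  have g' := Q.dist_gate u hy
  obtain ⟨w1, w2, w3⟩ := Q.isGraphMedian_median a b u
  set w := Q.median a b u
  have t := Q.dist_triangle x w y
  have c1 := Q.dist_comm x w
  have c2 := Q.dist_comm x u
  have h0 : Q.graph.dist u w = 0 := by omega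
  have : u = w := (Q.connected.dist_eq_zero_iff).1 h0
  rw [← this] at w1
  exact w1

/-! ### The Helly property -/

/-- The median of one point from each pairwise intersection lies in all three sets. -/
theorem exists_mem_inter_three {A B C : Set Q.V} (hA : Q.IsConvex A) (hB : Q.IsConvex B)
    (hC : Q.IsConvex C) (hAB : (A ∩ B).Nonempty) (hAC : (A ∩ C).Nonempty)
    (hBC : (B ∩ C).Nonempty) : (A ∩ B ∩ C).Nonempty := by
  obtain ⟨x, xA, xB⟩ := hAB
  obtain ⟨y, yA, yC⟩ := hAC
  obtain ⟨z, zB, zC⟩ := hBC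
  refine ⟨Q.median x y z, ⟨hA x xA y yA z, ?_⟩, ?_⟩
  · rw [Q.median_swap_right]
    exact hB x xB z zB y
  · rw [Q.median_swap_left, Q.median_swap_right]
    exact hC y yC z zC x

/-- The Helly property of convex sets. -/
theorem helly {ι : Type*} (F : Finset ι) (C : ι → Set Q.V) (hC : ∀ i, Q.IsConvex (C i))
    (hF : ∀ i ∈ F, ∀ j ∈ F, (C i ∩ C j).Nonempty) {B : Set Q.V} (hB : Q.IsConvex B)
    (hne : B.Nonempty) (hBC : ∀ i ∈ F, (B ∩ C i).Nonempty) :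
    ∃ x ∈ B, ∀ i ∈ F, x ∈ C i := by
  classical
  induction F using Finset.induction_on generalizing B with
  | empty =>
    obtain ⟨x, hx⟩ := hne
    exact ⟨x, hx, by simp⟩
  | insert i F _ ih =>
    obtain ⟨x, hx, hx'⟩ := ih (B := B ∩ C i)
      (fun j hj k hk => hF j (Finset.mem_insert_of_mem hj) k (Finset.mem_insert_of_mem hk))
      (hB.inter (hC i)) (hBC i (Finset.mem_insert_self i F)) (fun j hj =>
        exists_mem_inter_three hB (hC i) (hC j) (hBC i (Finset.mem_insert_self i F))
          (hBC j (Finset.mem_insert_of_mem hj))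
          (hF i (Finset.mem_insert_self i F) j (Finset.mem_insert_of_mem hj)))
    refine ⟨x, hx.1, fun j hj => ?_⟩
    rcases Finset.mem_insert.1 hj with rfl | hj
    · exact hx.2
    · exact hx' j hj

/-- The Helly property for arbitrary families; there are only finitely many sets of vertices. -/
theorem helly_sUnion (S : Set (Set Q.V)) (hS : ∀ A ∈ S, Q.IsConvex A)
    (hpair : ∀ A ∈ S, ∀ B ∈ S, (A ∩ B).Nonempty) : ∃ x, ∀ A ∈ S, x ∈ A := by
  classical
  have := Q.finite
  have := Fintype.ofFinite S
  obtain ⟨x₀⟩ := Q.connected.nonempty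
  obtain ⟨x, -, hx⟩ := helly (Q := Q) (ι := S) Finset.univ
    (fun A => A) (fun A => hS A A.2) (fun A _ B _ => hpair A A.2 B B.2) Q.isConvex_univ
    ⟨x₀, trivial⟩ (fun A _ => by
      obtain ⟨y, hy, -⟩ := hpair A A.2 A A.2
      exact ⟨y, trivial, hy⟩)
  exact ⟨x, fun A hA => hx ⟨A, hA⟩ (Finset.mem_univ _)⟩

/-! ### Cubes spanned by neighbours of a vertex -/

theorem exists_neighbour_between {p a : Q.V} (h : p ≠ a) :
    ∃ q, Q.graph.dist p q = 1 ∧ Q.graph.dist q a + 1 = Q.graph.dist p a := by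
  obtain ⟨w, hw⟩ := Q.connected.exists_walk_length_eq_dist p a
  cases w with
  | nil => exact absurd rfl h
  | cons hadj w' =>
    rename_i q
    have h1 : Q.graph.dist p q = 1 := SimpleGraph.dist_eq_one_iff_adj.2 hadj
    refine ⟨q, h1, ?_⟩
    have h2 := SimpleGraph.dist_le w'
    have h3 := Q.dist_triangle p q a
    rw [SimpleGraph.Walk.length_cons] at hw
    omega

theorem hammingDist_succ {k : ℕ} (x y : Fin (k + 1) → Bool) :
    hammingDist x y =
      (if x 0 = y 0 then 0 else 1) + hammingDist (Fin.tail x) (Fin.tail y) := by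
  unfold hammingDist
  rw [Fin.card_filter_univ_succ']
  congr 1
  by_cases h : x 0 = y 0 <;> simp [h]

theorem dist_neighbours {p q q' : Q.V} (h : Q.graph.dist p q = 1) (h' : Q.graph.dist p q' = 1)
    (hne : q ≠ q') : q ∈ Q.side p q' := by
  have h1 := dist_ne_dist_of_adj h' q
  have h2 := dist_symm_one h
  have h3 : Q.graph.dist q q' ≠ 0 := fun h0 => hne (Q.connected.dist_eq_zero_iff.1 h0)
  rw [mem_side]
  omega

/-- Translating a vertex of `[p,a]` across the hyperplane separating `p` from its neighbour `q`. -/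
theorem dist_translate {p a q e : Q.V} (hq : Q.graph.dist p q = 1)
    (hqa : Q.graph.dist q a + 1 = Q.graph.dist p a)
    (he : Q.graph.dist p e + Q.graph.dist e a = Q.graph.dist p a) (heq : e ∈ Q.side p q) :
    Q.graph.dist e (Q.median e q a) = 1 ∧ Q.median e q a ∈ Q.side q p ∧
      Q.graph.dist p (Q.median e q a) + Q.graph.dist (Q.median e q a) a = Q.graph.dist p a := by
  obtain ⟨h1, h2, h3⟩ := Q.isGraphMedian_median e q a
  set y := Q.median e q a
  rw [mem_side] at heq ⊢
  have t1 := Q.dist_triangle e p q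
  have t2 := Q.dist_triangle p y a
  have t3 := Q.dist_triangle p q y
  have t4 := Q.dist_triangle p e y
  have c1 := Q.dist_comm e p
  have c2 := Q.dist_comm y q
  have c3 := Q.dist_comm y p
  -- The distance from `e` to the median is half of `d(e,q) + d(e,a) - d(q,a)`, and that sum is `2`.
  omega

/-- The translate of `e'` cannot be nearer to `e` than `e'` is: it would lie between them, in the
convex side of `p`. The second equality holds because the translate of `e` is the gate of `e` in
`[q,a]`. -/
theorem dist_translate_translate {p a q e e' : Q.V} (hq : Q.graph.dist p q = 1)
    (hqa : Q.graph.dist q a + 1 = Q.graph.dist p a)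
    (he : Q.graph.dist p e + Q.graph.dist e a = Q.graph.dist p a) (heq : e ∈ Q.side p q)
    (he' : Q.graph.dist p e' + Q.graph.dist e' a = Q.graph.dist p a) (heq' : e' ∈ Q.side p q) :
    Q.graph.dist e (Q.median e' q a) = Q.graph.dist e e' + 1 ∧
      Q.graph.dist (Q.median e q a) (Q.median e' q a) = Q.graph.dist e e' := by
  obtain ⟨h1, h2, h3⟩ := dist_translate hq hqa he heq
  obtain ⟨h1', h2', h3'⟩ := dist_translate hq hqa he' heq'
  obtain ⟨-, g, -⟩ := Q.isGraphMedian_median e' q a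
  have hg : Q.median q a e = Q.median e q a := by
    rw [Q.median_swap_right, Q.median_swap_left]
  have hgate := Q.dist_gate e g
  rw [hg] at hgate
  set y := Q.median e q a
  set y' := Q.median e' q a
  have key : Q.graph.dist e y' = Q.graph.dist e e' + 1 := by
    rcases Nat.lt_or_ge (Q.graph.dist e e') (Q.graph.dist e y') with h | h
    · have := Q.dist_triangle e e' y'
      omega
    · have hne := dist_ne_dist_of_adj h1' e
      have t := Q.dist_triangle e y' e'
      have c := Q.dist_comm y' e'
      exact absurd ((isConvex_side (dist_symm_one hq)).mem_of_between heq heq'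
        (u := y') (by omega)) ((notMem_side (dist_symm_one hq)).2 h2')
  exact ⟨key, by omega⟩

/-- The neighbours of `p` in `[p,a]` span a cube. -/
theorem exists_cube (p a : Q.V) (k : ℕ) (q : Fin k → Q.V) (hinj : Function.Injective q)
    (hq : ∀ i, Q.graph.dist p (q i) = 1)
    (hqa : ∀ i, Q.graph.dist (q i) a + 1 = Q.graph.dist p a) :
    ∃ e : (Fin k → Bool) → Q.V, (∀ x y, Q.graph.dist (e x) (e y) = hammingDist x y) ∧
      e (fun _ => false) = p ∧
      (∀ x, Q.graph.dist p (e x) + Q.graph.dist (e x) a = Q.graph.dist p a) ∧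
      (∀ x i, x i = true → e x ∈ Q.side (q i) p) ∧
      ∀ x q', Q.graph.dist p q' = 1 → q' ∉ Set.range q → e x ∈ Q.side p q' := by
  -- Each new neighbour doubles the cube by translation across its hyperplane. The last clause, that
  -- the cube stays on the side of `p` for all unused neighbours, is what lets the induction
  -- proceed.
  induction k with
  | zero =>
    refine ⟨fun _ => p, fun x y => ?_, rfl, fun x => ?_, fun x i => i.elim0, fun x q' h _ => ?_⟩
    · rw [Subsingleton.elim x y]
      simp
    · simp
    · rw [mem_side, SimpleGraph.dist_self, h]
      exact one_pos
  | succ k ih =>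
    obtain ⟨e, e1, e2, e3, e4, e5⟩ := ih (Fin.tail q)
      (hinj.comp (Fin.succ_injective k)) (fun i => hq _) (fun i => hqa _)
    have h0 : ∀ x, e x ∈ Q.side p (q 0) := fun x => e5 x _ (hq 0) (by
      rintro ⟨i, hi⟩
      exact (Fin.succ_ne_zero i) (hinj hi))
    have haq : ∀ i, a ∈ Q.side (q i) p := fun i => by
      have := hqa i
      have c1 := Q.dist_comm a (q i)
      have c2 := Q.dist_comm a p
      rw [mem_side]
      omega
    refine ⟨fun x => if x 0 = true then Q.median (e (Fin.tail x)) (q 0) a else e (Fin.tail x),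
      fun x y => ?_, ?_, fun x => ?_, fun x i => ?_, fun x q' hq' hr => ?_⟩
    · obtain ⟨k1, k2⟩ := dist_translate_translate (hq 0) (hqa 0) (e3 (Fin.tail x))
        (h0 (Fin.tail x)) (e3 (Fin.tail y)) (h0 (Fin.tail y))
      obtain ⟨k3, -⟩ := dist_translate_translate (hq 0) (hqa 0) (e3 (Fin.tail y))
        (h0 (Fin.tail y)) (e3 (Fin.tail x)) (h0 (Fin.tail x))
      rw [hammingDist_succ, ← e1]
      by_cases hx : x 0 = true <;> by_cases hy : y 0 = true <;> simp only [hx, hy]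
      · simpa using k2
      · simp only [if_true]
        rw [Q.dist_comm, Q.dist_comm (e (Fin.tail x))]
        simpa [add_comm] using k3
      · simpa [add_comm] using k1
      · simp
    · simp only [Bool.false_eq_true, if_false]
      exact e2
    · by_cases hx : x 0 = true
      · simp only [hx, if_true]
        exact (dist_translate (hq 0) (hqa 0) (e3 _) (h0 _)).2.2
      · simp only [hx]
        exact e3 _
    · refine Fin.cases (fun hx => ?_) (fun i hx => ?_) i
      · simp only [hx, if_true]
        exact (dist_translate (hq 0) (hqa 0) (e3 _) (h0 _)).2.1
      · have h4 := e4 (Fin.tail x) i hx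
        by_cases hx0 : x 0 = true
        · simp only [hx0, if_true]
          rw [Q.median_swap_right]
          exact isConvex_side (hq i.succ) _ h4 _ (haq i.succ) _
        · simp only [hx0]
          exact h4
    · have h5 := e5 (Fin.tail x) q' hq' (by
        rintro ⟨i, hi⟩
        exact hr ⟨i.succ, hi⟩)
      by_cases hx0 : x 0 = true
      · simp only [hx0, if_true]
        exact isConvex_side (dist_symm_one hq') _ h5 _
          (dist_neighbours (hq 0) hq' (fun h => hr ⟨0, h⟩)) _
      · simp only [hx0]
        exact h5

theorem le_of_isometric_cube {ν : ℕ} (hdim : Q.dim ≤ (ν : ℕ∞)) {k : ℕ}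
    (e : (Fin k → Bool) → Q.V) (he : ∀ x y, Q.graph.dist (e x) (e y) = hammingDist x y) :
    k ≤ ν := by
  have hinj : Function.Injective e := fun x y hxy => by
    have := he x y
    rw [hxy, SimpleGraph.dist_self] at this
    exact hammingDist_eq_zero.1 this.symm
  have hemb : Nonempty (cubeGraph k ↪g Q.graph) := by
    refine ⟨⟨⟨e, hinj⟩, fun {x y} => ?_⟩⟩
    change Q.graph.Adj (e x) (e y) ↔ (cubeGraph k).Adj x y
    rw [← SimpleGraph.dist_eq_one_iff_adj, he, cubeGraph, SimpleGraph.fromRel_adj,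
      hammingDist_comm y x, or_self]
    refine ⟨fun h => ⟨fun hxy => ?_, h⟩, fun h => h.2⟩
    rw [hxy, hammingDist_self] at h
    exact zero_ne_one h
  have h2 : (k : ℕ∞) ≤ Q.dim := le_iSup₂_of_le (f := fun (n : ℕ)
    (_ : Nonempty (cubeGraph n ↪g Q.graph)) => (n : ℕ∞)) k hemb le_rfl
  exact_mod_cast h2.trans hdim

/-- In dimension at most `ν`, a vertex `p` has at most `ν` neighbours in `[p,a]`, and some vertex
of `[p,a]` at distance at most `ν` from `p` lies beyond all the corresponding hyperplanes. -/
theorem exists_neighbours {ν : ℕ} (hdim : Q.dim ≤ (ν : ℕ∞)) (p a : Q.V) :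
    ∃ N : Finset Q.V,
      (∀ q, q ∈ N ↔ Q.graph.dist p q = 1 ∧ Q.graph.dist q a + 1 = Q.graph.dist p a) ∧
      N.card ≤ ν ∧ ∃ y, Q.graph.dist p y ≤ ν ∧
        Q.graph.dist p y + Q.graph.dist y a = Q.graph.dist p a ∧ ∀ q ∈ N, y ∈ Q.side q p := by
  classical
  have := Q.finite
  have := Fintype.ofFinite Q.V
  set N : Finset Q.V := Finset.univ.filter
    (fun q => Q.graph.dist p q = 1 ∧ Q.graph.dist q a + 1 = Q.graph.dist p a) with hN
  have hmem : ∀ q, q ∈ N ↔ Q.graph.dist p q = 1 ∧ Q.graph.dist q a + 1 = Q.graph.dist p a := by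
    simp [hN]
  let q : Fin N.card → Q.V := fun i => N.equivFin.symm i
  obtain ⟨e, e1, e2, e3, e4, -⟩ := exists_cube p a N.card q
    (Subtype.val_injective.comp N.equivFin.symm.injective)
    (fun i => ((hmem _).1 (N.equivFin.symm i).2).1)
    (fun i => ((hmem _).1 (N.equivFin.symm i).2).2)
  have hk := le_of_isometric_cube hdim e e1
  refine ⟨N, hmem, hk, e (fun _ => true), ?_, e3 _, fun q' hq' => ?_⟩
  · have h := e1 (fun _ => false) (fun _ => true)
    rw [e2] at h
    rw [h]
    exact hammingDist_le_card_fintype.trans (by simpa using hk)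
  · have := e4 (fun _ => true) (N.equivFin ⟨q', hq'⟩) rfl
    simpa [q] using this

/-! ### Quasiconvex functions on hulls -/

variable (Q)

/-- The median-convex hull. -/
def hull (A : Set Q.V) : Set Q.V := ⋂₀ {C | Q.IsConvex C ∧ A ⊆ C}

variable {Q}

theorem subset_hull (A : Set Q.V) : A ⊆ Q.hull A := Set.subset_sInter fun _ hC => hC.2

theorem isConvex_hull (A : Set Q.V) : Q.IsConvex (Q.hull A) :=
  fun x hx y hy z C hC => hC.1 x (hx C hC) y (hy C hC) z

theorem hull_subset {A C : Set Q.V} (hC : Q.IsConvex C) (h : A ⊆ C) : Q.hull A ⊆ C :=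
  Set.sInter_subset_of_mem ⟨hC, h⟩

theorem mem_side_of_between {p q x x' : Q.V} (hx : x ∈ Q.side p q)
    (hx' : Q.graph.dist x x' + Q.graph.dist x' p = Q.graph.dist x p) : x' ∈ Q.side p q := by
  rw [mem_side] at hx ⊢
  have := Q.dist_triangle x x' q
  omega

/-- A coarsely quasiconvex function on a complex of dimension at most `ν` increases by a bounded
amount on the hull of a sublevel set. -/
theorem le_of_mem_hull {ν : ℕ} (hdim : Q.dim ≤ (ν : ℕ∞)) {f : Q.V → ℝ} {k t : ℝ} (hk : 0 ≤ k)
    (hf : ∀ x y z, f (Q.median x y z) ≤ max (f x) (f y) + k) {p : Q.V}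
    (hp : p ∈ Q.hull {x | f x ≤ t}) : f p ≤ t + ν * k := by
  classical
  have hne : {x | f x ≤ t}.Nonempty := by
    by_contra h
    rw [Set.not_nonempty_iff_eq_empty] at h
    rw [h] at hp
    exact hull_subset (C := ∅) (fun x hx => hx.elim) subset_rfl hp
  obtain ⟨a, ha⟩ := hne
  obtain ⟨N, hN, hcard, -⟩ := exists_neighbours hdim p a
  -- Otherwise the halfspace beyond `q` contains the sublevel set, hence its hull, hence `p`.
  have hA : ∀ q ∈ N, ∃ b, f b ≤ t ∧ b ∈ Q.side p q := by
    intro q hq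
    have hpq := ((hN q).1 hq).1
    by_contra! h
    have hsub : {x | f x ≤ t} ⊆ Q.side q p := fun x hx =>
      (notMem_side (dist_symm_one hpq)).1 (h x hx)
    have := hull_subset (isConvex_side hpq) hsub hp
    rw [mem_side, SimpleGraph.dist_self] at this
    omega
  -- Walk from `a` towards `p`, one median for each `q`. Each step costs `k`, enters the side of `p`
  -- against `q`, and leaves none entered before. After all of `N`, at most `ν` steps, the walk is
  -- at `p`.
  have key : ∀ T : Finset Q.V, T ⊆ N → ∃ x,
      Q.graph.dist a x + Q.graph.dist x p = Q.graph.dist a p ∧ f x ≤ t + T.card * k ∧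
      ∀ q ∈ T, x ∈ Q.side p q := by
    intro T
    induction T using Finset.induction_on with
    | empty =>
      intro _
      exact ⟨a, by simp, by simpa using ha, by simp⟩
    | insert q T hqT ih =>
      intro hT
      obtain ⟨x, hx1, hx2, hx3⟩ := ih ((Finset.subset_insert _ _).trans hT)
      obtain ⟨b, hb, hbq⟩ := hA q (hT (Finset.mem_insert_self _ _))
      obtain ⟨-, m2, m3⟩ := Q.isGraphMedian_median x b p
      refine ⟨Q.median x b p, ?_, ?_, fun q' hq' => ?_⟩
      · have t1 := Q.dist_triangle a x (Q.median x b p)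
        have t2 := Q.dist_triangle a (Q.median x b p) p
        omega
      · rw [Finset.card_insert_of_notMem hqT]
        push_cast
        have h1 := hf x b p
        have h2 : 0 ≤ (T.card : ℝ) * k := by positivity
        have h3 : max (f x) (f b) ≤ t + T.card * k := max_le hx2 (by linarith)
        linarith
      · rcases Finset.mem_insert.1 hq' with rfl | hq'
        · exact mem_side_of_between hbq m2
        · exact mem_side_of_between (hx3 q' hq') m3
  obtain ⟨x, hx1, hx2, hx3⟩ := key N subset_rfl
  have hxp : p = x := by
    by_contra hne
    obtain ⟨q, hq1, hq2⟩ := exists_neighbour_between hne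
    have hqN : q ∈ N := by
      rw [hN]
      refine ⟨hq1, ?_⟩
      have t1 := Q.dist_triangle q x a
      have t2 := Q.dist_triangle p q a
      have c1 := Q.dist_comm a x
      have c2 := Q.dist_comm x p
      have c3 := Q.dist_comm a p
      omega
    have h3 := hx3 q hqN
    rw [mem_side] at h3
    have c1 := Q.dist_comm x p
    have c2 := Q.dist_comm x q
    omega
  have h4 : (N.card : ℝ) * k ≤ ν * k := by
    gcongr
  rw [hxp]
  linarith

/-! ### Chains of halfspaces -/

/-- Two vertices far apart in a complex of dimension at most `ν` are separated by a long chain of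
halfspaces: here `f` counts the halfspaces of the chain that contain a given vertex. -/
theorem exists_chain {ν : ℕ} (hdim : Q.dim ≤ (ν : ℕ∞)) (n : ℕ) (a b : Q.V)
    (hab : n * ν < Q.graph.dist a b) :
    ∃ f : Q.V → ℕ, f a = 0 ∧ n + 1 ≤ f b ∧
      (∀ t, Q.IsConvex {x | t ≤ f x} ∧ Q.IsConvex {x | t ≤ f x}ᶜ) ∧
      ∀ u v, Q.graph.dist u v = 1 → f u ≤ f v + 1 := by
  classical
  induction n generalizing a with
  | zero =>
    have hne : a ≠ b := by
      rintro rfl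
      simp at hab
    obtain ⟨q, hq1, hq2⟩ := exists_neighbour_between hne
    refine ⟨fun x => if x ∈ Q.side q a then 1 else 0, ?_, ?_, fun t => ?_, fun u v _ => ?_⟩
    · simp [mem_side]
    · have : b ∈ Q.side q a := by
        rw [mem_side, Q.dist_comm b q, Q.dist_comm b a]
        omega
      simp [this]
    · rcases Nat.lt_trichotomy t 1 with ht | rfl | ht
      · obtain rfl : t = 0 := by omega
        simpa using ⟨Q.isConvex_univ, fun x hx => hx.elim⟩
      · have : {x | 1 ≤ if x ∈ Q.side q a then 1 else 0} = Q.side q a := by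
          ext x
          by_cases hx : x ∈ Q.side q a <;> simp [hx]
        rw [this]
        exact ⟨isConvex_side hq1, isConvex_compl_side hq1⟩
      · have : {x | t ≤ if x ∈ Q.side q a then 1 else 0} = ∅ := by
          ext x
          by_cases hx : x ∈ Q.side q a <;> simp [hx] <;> omega
        rw [this]
        simpa using ⟨fun x hx => hx.elim, Q.isConvex_univ⟩
    · by_cases hu : u ∈ Q.side q a <;> simp [hu]
  | succ n ih =>
    obtain ⟨N, hN, -, y, hy1, hy2, hy3⟩ := exists_neighbours hdim a b
    obtain ⟨f, f1, f2, f3, f4⟩ := ih y (by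
      rw [add_mul, one_mul] at hab
      omega)
    -- The largest halfspace of the chain separating `y` from `b`. The chain grows by a halfspace
    -- adjacent to `a` that contains `H`.
    set H : Set Q.V := {x | 1 ≤ f x} with hH
    have hyH : y ∉ H := by simp [hH, f1]
    have hbH : b ∈ H := by
      simp only [hH, Set.mem_ofPred_eq]
      omega
    have haH : a ∉ H := fun haH => hyH ((f3 1).1.mem_of_between haH hbH hy2)
    have hW : ∃ q ∈ N, H ⊆ Q.side q a := by
      by_contra! hcon
      -- If no such halfspace exists, Helly gives `z ∈ H ∩ [a,b]` beyond none of the hyperplanes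
      -- indexed by `N`, although a first step from `a` to `z` crosses one. The union only makes the
      -- family convex at indices outside `N`.
      obtain ⟨z, ⟨hz1, hz2⟩, hz3⟩ := helly N (fun q => (Q.side q a)ᶜ ∪ {x | q ∉ N}) (fun q => by
          by_cases hq : q ∈ N
          · simpa [hq] using isConvex_compl_side ((hN q).1 hq).1
          · simpa [hq] using Q.isConvex_univ)
        (fun i _ j _ => ⟨a, by simp [mem_side], by simp [mem_side]⟩)
        ((f3 1).1.inter (isConvex_between a b)) ⟨b, hbH, by simp⟩
        (fun q hq => by
          obtain ⟨w, hw1, hw2⟩ := Set.not_subset.1 (hcon q hq)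
          obtain ⟨z, ⟨z1, z2⟩, z3⟩ := exists_mem_inter_three (f3 1).1 (isConvex_between a b)
            (isConvex_compl_side ((hN q).1 hq).1) ⟨b, hbH, by simp⟩ ⟨w, hw1, hw2⟩
            ⟨a, by simp, by simp [mem_side]⟩
          exact ⟨z, ⟨z1, z2⟩, Or.inl z3⟩)
      have hne : a ≠ z := by
        rintro rfl
        exact haH hz1
      obtain ⟨q, hq1, hq2⟩ := exists_neighbour_between hne
      have hz2' : Q.graph.dist a z + Q.graph.dist z b = Q.graph.dist a b := hz2
      have hqN : q ∈ N := by
        rw [hN]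
        refine ⟨hq1, ?_⟩
        have t1 := Q.dist_triangle q z b
        have t2 := Q.dist_triangle a q b
        omega
      rcases hz3 q hqN with h | h
      · apply h
        rw [mem_side, Q.dist_comm z q, Q.dist_comm z a]
        omega
      · exact h hqN
    obtain ⟨q, hqN, hqH⟩ := hW
    obtain ⟨hq1, hq2⟩ := (hN q).1 hqN
    have haW : a ∉ Q.side q a := by simp [mem_side]
    have hfW : ∀ x, x ∉ Q.side q a → f x = 0 := fun x hx => by
      by_contra h
      exact hx (hqH (Nat.one_le_iff_ne_zero.2 h))
    refine ⟨fun x => f x + if x ∈ Q.side q a then 1 else 0, ?_, ?_, fun t => ?_,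
      fun u v huv => ?_⟩
    · simp [haW, hfW a haW]
    · simp only [hqH hbH, if_true]
      omega
    · rcases Nat.lt_trichotomy t 1 with ht | rfl | ht
      · obtain rfl : t = 0 := by omega
        simpa using ⟨Q.isConvex_univ, fun x hx => hx.elim⟩
      · have : {x | 1 ≤ f x + if x ∈ Q.side q a then 1 else 0} = Q.side q a := by
          ext x
          by_cases hx : x ∈ Q.side q a
          · simp [hx]
          · simp [hx, hfW x hx]
        rw [this]
        exact ⟨isConvex_side hq1, isConvex_compl_side hq1⟩
      · have : {x | t ≤ f x + if x ∈ Q.side q a then 1 else 0} = {x | t - 1 ≤ f x} := by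
          ext x
          by_cases hx : x ∈ Q.side q a
          · simp [hx]
          · simp [hx, hfW x hx]
            omega
        rw [this]
        exact f3 (t - 1)
    · have h4 := f4 u v huv
      by_cases hu : u ∈ Q.side q a
      · by_cases hv : v ∈ Q.side q a
        · simpa [hu, hv] using h4
        · have hfv := hfW v hv
          simp only [hu, hv, if_true, if_false, hfv]
          -- An edge crossing both the new halfspace and `H` would make them equal, but `y` lies
          -- only in the new one.
          suffices f u = 0 by omega
          by_contra hfu
          have e1 := eq_side_of_crossing (f3 1).1 (f3 1).2 huv
            (show u ∈ H from Nat.one_le_iff_ne_zero.2 hfu) (show v ∉ H by simp [hH, hfv])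
          have e2 := eq_side_of_crossing (isConvex_side hq1) (isConvex_compl_side hq1) huv hu hv
          apply hyH
          have := hy3 q hqN
          rw [e2, ← e1] at this
          exact this
      · simp [hu, hfW u hu]

theorem lipschitz_of_adj {f : Q.V → ℕ} (hf : ∀ u v, Q.graph.dist u v = 1 → f u ≤ f v + 1)
    (u v : Q.V) : f u ≤ f v + Q.graph.dist u v := by
  induction h : Q.graph.dist u v generalizing u with
  | zero => rw [Q.connected.dist_eq_zero_iff.1 h, add_zero]
  | succ n ih =>
    have hne : u ≠ v := by
      rintro rfl
      simp at h
    obtain ⟨q, hq1, hq2⟩ := exists_neighbour_between hne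
    have h1 := ih q (by omega)
    have h2 := hf u q hq1
    omega

/-- On a complex of dimension at most `ν`, the `ℓ¹` distance of two vertices is detected, up to the
factor `ν + 1`, by a contracting median homomorphism to `ℕ`. -/
theorem exists_contracting_map {ν : ℕ} (hdim : Q.dim ≤ (ν : ℕ∞)) (a b : Q.V) :
    ∃ f : Q.V → ℕ, f a = 0 ∧ Q.graph.dist a b ≤ (ν + 1) * f b ∧
      (∀ x y z, (f (Q.median x y z) : ℝ) = realMedian (f x) (f y) (f z)) ∧
      ∀ u v, f u ≤ f v + Q.graph.dist u v := by
  rcases Nat.eq_zero_or_pos (Q.graph.dist a b) with h0 | hpos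
  · exact ⟨fun _ => 0, rfl, by simp [h0], by simp [realMedian], by simp⟩
  -- Using `ν + 1` keeps the divisor below positive even when `ν = 0`.
  have hdim' : Q.dim ≤ ((ν + 1 : ℕ) : ℕ∞) := hdim.trans (by exact_mod_cast Nat.le_succ ν)
  have hdiv := Nat.div_add_mod (Q.graph.dist a b - 1) (ν + 1)
  have hmod := Nat.mod_lt (Q.graph.dist a b - 1) (Nat.add_pos_right ν one_pos)
  set n := (Q.graph.dist a b - 1) / (ν + 1)
  obtain ⟨f, f1, f2, f3, f4⟩ := exists_chain hdim' n a b (by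
    rw [mul_comm]
    omega)
  refine ⟨f, f1, ?_, fun x y z => ?_, lipschitz_of_adj f4⟩
  · have := Nat.mul_le_mul_left (ν + 1) f2
    rw [Nat.mul_add, mul_one] at this
    omega
  -- Convexity of superlevel sets gives the lower bounds, convexity of their complements the upper
  -- ones; over all three pairs they determine the median.
  · have hmin : ∀ x y z, min (f x) (f y) ≤ f (Q.median x y z) := fun x y z =>
      (f3 (min (f x) (f y))).1 x (min_le_left (f x) (f y)) y (min_le_right (f x) (f y)) z
    have hmax : ∀ x y z, f (Q.median x y z) ≤ max (f x) (f y) := fun x y z => by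
      have := (f3 (max (f x) (f y) + 1)).2 x (by simp) y (by simp) z
      exact Nat.lt_succ_iff.1 (not_le.1 this)
    have h1 := hmin x y z
    have h2 := hmax x y z
    have h3 := hmin x z y
    have h4 := hmax x z y
    have h5 := hmin y z x
    have h6 := hmax y z x
    rw [← Q.median_swap_right] at h3 h4
    rw [Q.median_swap_right y z x, ← Q.median_swap_left] at h5 h6
    have : f (Q.median x y z) = max (min (f x) (f y)) (min (max (f x) (f y)) (f z)) := by
      omega
    rw [this, realMedian]
    push_cast
    rfl

end FiniteCAT0CubeComplex

/-! ### The median of three real numbers -/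

theorem map_realMedian {g : ℝ → ℝ} (hg : Monotone g) (a b c : ℝ) :
    g (realMedian a b c) = realMedian (g a) (g b) (g c) := by
  simp only [realMedian, hg.map_max, hg.map_min]

theorem realMedian_neg (a b c : ℝ) : realMedian (-a) (-b) (-c) = -realMedian a b c := by
  simp only [realMedian, max_def, min_def]
  split_ifs <;> linarith

theorem realMedian_le_max (a b c : ℝ) : realMedian a b c ≤ max a b :=
  max_le (min_le_max) (min_le_left _ _)

theorem realMedian_mono {a b c a' b' c' : ℝ} (ha : a ≤ a') (hb : b ≤ b') (hc : c ≤ c') :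
    realMedian a b c ≤ realMedian a' b' c' := by
  unfold realMedian
  gcongr

theorem realMedian_add (a b c e : ℝ) :
    realMedian (a + e) (b + e) (c + e) = realMedian a b c + e :=
  (map_realMedian (g := fun t => t + e) (fun _ _ h => by simpa using h) a b c).symm

theorem realMedian_le_max_zero {b c : ℝ} : realMedian 0 b c ≤ max 0 c := by
  simp only [realMedian, max_def, min_def]
  split_ifs <;> linarith

theorem realMedian_le_max_zero' {b c : ℝ} : realMedian b 0 c ≤ max 0 c := by
  simp only [realMedian, max_def, min_def]
  split_ifs <;> linarith

variable {X : Type*} [MetricSpace X] {μ : X → X → X → X} {K : ℝ}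

/-! ### Contractions -/

theorem IsContraction.neg {Φ : X → ℝ} (h : IsContraction μ K Φ) :
    IsContraction μ K (fun x => -Φ x) := by
  refine ⟨fun x y => ?_, fun a b c => ?_⟩
  · rw [← abs_neg]
    simpa [neg_add_eq_sub, add_comm, sub_eq_add_neg] using h.1 x y
  · rw [realMedian_neg, ← abs_neg]
    simpa [neg_add_eq_sub, add_comm, sub_eq_add_neg] using h.2 a b c

theorem IsContraction.add_const {Φ : X → ℝ} (h : IsContraction μ K Φ) (e : ℝ) :
    IsContraction μ K (fun x => Φ x + e) := by
  refine ⟨fun x y => ?_, fun a b c => ?_⟩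
  · simpa using h.1 x y
  · rw [realMedian_add]
    simpa using h.2 a b c

theorem isContraction_zero (hK : 0 ≤ K) : IsContraction μ K (fun _ => 0) := by
  refine ⟨fun x y => ?_, fun a b c => ?_⟩
  · simpa using add_nonneg dist_nonneg hK
  · simpa [realMedian] using hK

/-- Contractions may be shifted and negated, so the normalisation in `sigmaSet` loses nothing. -/
theorem abs_sub_le_sigma (hK : 0 ≤ K) {Φ : X → ℝ} (h : IsContraction μ K Φ) (x y : X) :
    |Φ x - Φ y| ≤ sigma μ K x y := by
  have hub := (isLUB_sigma μ hK x y).1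
  rcases le_total (Φ x) (Φ y) with hle | hle
  · rw [abs_sub_comm, abs_of_nonneg (sub_nonneg.2 hle)]
    exact hub ⟨sub_nonneg.2 hle, fun z => Φ z + -Φ x, h.add_const _, by ring, by ring⟩
  · rw [abs_of_nonneg (sub_nonneg.2 hle)]
    exact hub ⟨sub_nonneg.2 hle, fun z => -Φ z + Φ x, h.neg.add_const _, by ring, by ring⟩

theorem sub_le_sigma (hK : 0 ≤ K) {Φ : X → ℝ} (h : IsContraction μ K Φ) (x y : X) :
    Φ y - Φ x ≤ sigma μ K x y := by
  have := (abs_le.1 (abs_sub_le_sigma hK h x y)).1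
  linarith

theorem sigma_le (hK : 0 ≤ K) {x y : X} {s : ℝ}
    (h : ∀ Φ : X → ℝ, IsContraction μ K Φ → Φ y - Φ x ≤ s) : sigma μ K x y ≤ s := by
  refine (isLUB_sigma μ hK x y).2 ?_
  rintro r ⟨-, Φ, hΦ, h0, rfl⟩
  simpa [h0] using h Φ hΦ

theorem sigma_nonneg (hK : 0 ≤ K) (x y : X) : 0 ≤ sigma μ K x y := by
  simpa using abs_sub_le_sigma hK (isContraction_zero (μ := μ) hK) x y

theorem sigma_comm (hK : 0 ≤ K) (x y : X) : sigma μ K x y = sigma μ K y x := by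
  have key : ∀ x y : X, sigma μ K x y ≤ sigma μ K y x := fun x y =>
    sigma_le hK fun Φ hΦ => (le_abs_self _).trans (abs_sub_le_sigma hK hΦ y x)
  exact le_antisymm (key x y) (key y x)

theorem sigma_self (hK : 0 ≤ K) (x : X) : sigma μ K x x = 0 :=
  le_antisymm (sigma_le hK fun Φ _ => by simp) (sigma_nonneg hK x x)

theorem sigma_triangle (hK : 0 ≤ K) (x y z : X) :
    sigma μ K x z ≤ sigma μ K x y + sigma μ K y z :=
  sigma_le hK fun Φ hΦ => by
    have h1 := sub_le_sigma hK hΦ x y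
    have h2 := sub_le_sigma hK hΦ y z
    linarith

theorem sigma_le_dist_add (hK : 0 ≤ K) (x y : X) : sigma μ K x y ≤ dist x y + K :=
  sigma_le hK fun Φ hΦ => by
    have := (le_abs_self _).trans (hΦ.1 y x)
    rwa [dist_comm] at this

theorem isMetric_sigma (hK : 0 < K) : IsMetric (sigma μ K) := by
  classical
  refine ⟨fun x y => ⟨fun h => ?_, ?_⟩, sigma_comm hK.le, sigma_triangle hK.le⟩
  · by_contra hne
    have h01 : ∀ z : X, 0 ≤ (if z = y then K else 0) ∧ (if z = y then K else 0) ≤ K := fun z => by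
      split_ifs <;> constructor <;> linarith
    -- Any function with values in `[0,K]` is a `K`-contraction.
    have hΦ : IsContraction μ K (fun z => if z = y then K else 0) := by
      refine ⟨fun u v => ?_, fun a b c => ?_⟩
      · have h1 := h01 u
        have h2 := h01 v
        have h3 := dist_nonneg (x := u) (y := v)
        rw [abs_le]
        constructor <;> linarith
      · have h1 := h01 (μ a b c)
        have h2 := realMedian_mono (h01 a).1 (h01 b).1 (h01 c).1
        have h3 := realMedian_mono (h01 a).2 (h01 b).2 (h01 c).2
        simp only [realMedian, min_self, max_self] at h2 h3
        rw [abs_le]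
        constructor
        · simp only [realMedian]
          linarith
        · simp only [realMedian]
          linarith
    have := sub_le_sigma hK.le hΦ x y
    rw [h] at this
    simp only [if_true, hne, if_false] at this
    linarith
  · rintro rfl
    exact sigma_self hK.le x

theorem sigma_le_of_equivariant (hK : 0 ≤ K) (g : X ≃ᵢ X)
    (hg : ∀ x y z : X, g (μ x y z) = μ (g x) (g y) (g z)) (x y : X) :
    sigma μ K (g x) (g y) ≤ sigma μ K x y := by
  refine sigma_le hK fun Φ hΦ => ?_
  refine sub_le_sigma (Φ := fun z => Φ (g z)) hK ⟨fun u v => ?_, fun a b c => ?_⟩ x y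
  · rw [← g.dist_eq u v]
    exact hΦ.1 _ _
  · beta_reduce
    rw [hg]
    exact hΦ.2 _ _ _

theorem sigma_equivariant (hK : 0 ≤ K) (g : X ≃ᵢ X)
    (hg : ∀ x y z : X, g (μ x y z) = μ (g x) (g y) (g z)) (x y : X) :
    sigma μ K (g x) (g y) = sigma μ K x y := by
  refine le_antisymm (sigma_le_of_equivariant hK g hg x y) ?_
  have := sigma_le_of_equivariant (μ := μ) hK g.symm (fun x y z => by
    apply g.injective
    simp [hg]) (g x) (g y)
  simpa using this

/-! ### Gluing contractions -/

/-- A rough geodesic crosses the level `u` of a contraction. -/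
theorem exists_crossing {C : ℝ} {x y : X} {c : ℝ → X} (hx : c 0 = x) (hy : c (dist x y) = y)
    (hc : ∀ s ∈ Set.Icc (0 : ℝ) (dist x y), ∀ t ∈ Set.Icc (0 : ℝ) (dist x y),
      dist (c s) (c t) ≤ |s - t| + C) {Φ : X → ℝ} (hΦ : IsContraction μ K Φ) {u : ℝ}
    (hxu : Φ x < u) (hyu : u ≤ Φ y) :
    ∃ z, u ≤ Φ z ∧ Φ z ≤ u + 1 + C + K ∧ dist x z + dist z y ≤ dist x y + 2 * C := by
  set l := dist x y
  have hl : 0 ≤ l := dist_nonneg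
  set S : Set ℝ := {t | t ∈ Set.Icc (0 : ℝ) l ∧ Φ (c t) < u} with hS
  have h0 : (0 : ℝ) ∈ S := ⟨⟨le_rfl, hl⟩, by rwa [hx]⟩
  have hbdd : BddAbove S := ⟨l, fun t ht => ht.1.2⟩
  obtain ⟨t₁, ht₁, hlt⟩ := exists_lt_of_lt_csSup ⟨0, h0⟩ (sub_one_lt (sSup S))
  have ht₁' := ht₁.1
  set t₂ := min (t₁ + 1) l with ht₂
  have ht₂' : t₂ ∈ Set.Icc (0 : ℝ) l :=
    ⟨le_min (by linarith [ht₁'.1]) hl, min_le_right _ _⟩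
  have h12 : t₁ ≤ t₂ := le_min (by linarith) ht₁'.2
  have h21 : t₂ ≤ t₁ + 1 := min_le_left _ _
  have hu : u ≤ Φ (c t₂) := by
    rcases le_total (t₁ + 1) l with h | h
    · by_contra! hcon
      have := le_csSup hbdd (show t₂ ∈ S from ⟨ht₂', hcon⟩)
      rw [ht₂, min_eq_left h] at this
      linarith
    · rwa [ht₂, min_eq_right h, hy]
  refine ⟨c t₂, hu, ?_, ?_⟩
  · have h1 := (abs_le.1 (hΦ.1 (c t₂) (c t₁))).2
    have h2 := hc t₂ ht₂' t₁ ht₁'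
    rw [abs_of_nonneg (sub_nonneg.2 h12)] at h2
    linarith [ht₁.2]
  · have h1 := hc 0 ⟨le_rfl, hl⟩ t₂ ht₂'
    have h2 := hc t₂ ht₂' l ⟨hl, le_rfl⟩
    rw [hx, zero_sub, abs_neg, abs_of_nonneg ht₂'.1] at h1
    rw [hy, abs_sub_comm, abs_of_nonneg (sub_nonneg.2 ht₂'.2)] at h2
    linarith

/-- The glued function follows `Φ` up to `u`, rests on a plateau, then follows `Ψ` above `v`. The
plateau is wide enough to absorb the second additive error, so the constant stays `K`. -/
theorem IsContraction.glue (hK : 0 ≤ K) {C : ℝ} (hC : 0 ≤ C)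
    (hgeo : ∀ a b : X, ∃ f : ℝ → X, f 0 = a ∧ f (dist a b) = b ∧
      ∀ s ∈ Set.Icc (0 : ℝ) (dist a b), ∀ t ∈ Set.Icc (0 : ℝ) (dist a b),
        dist (f s) (f t) ≤ |s - t| + C)
    {Φ Ψ : X → ℝ} (hΦ : IsContraction μ K Φ) (hΨ : IsContraction μ K Ψ) {u v : ℝ}
    (hsep : ∀ x, Φ x ≤ u + (1 + 2 * C + K) → Ψ x < v - (1 + 2 * C + K)) :
    IsContraction μ K (fun x => min (Φ x) u + max (Ψ x - v) 0) := by
  constructor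
  · have key : ∀ x y, (min (Φ y) u + max (Ψ y - v) 0) - (min (Φ x) u + max (Ψ x - v) 0) ≤
        dist x y + K := by
      intro x y
      have hd : 0 ≤ dist x y := dist_nonneg
      have h1 := (le_abs_self _).trans (hΦ.1 y x)
      have h2 := (le_abs_self _).trans (hΨ.1 y x)
      rw [dist_comm y x] at h1 h2
      rcases le_or_gt u (Φ x) with hxu | hxu
      · rw [min_eq_right hxu]
        have h3 := min_le_right (Φ y) u
        have h4 : max (Ψ y - v) 0 ≤ max (Ψ x - v) 0 + (dist x y + K) :=
          max_le (by linarith [le_max_left (Ψ x - v) 0]) (by linarith [le_max_right (Ψ x - v) 0])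
        linarith
      · rw [min_eq_left hxu.le]
        have hΨx := hsep x (by linarith)
        rw [max_eq_right (a := Ψ x - v) (by linarith)]
        rcases le_or_gt (Ψ y) v with hyv | hyv
        · rw [max_eq_right (a := Ψ y - v) (by linarith)]
          linarith [min_le_left (Φ y) u]
        · rw [max_eq_left (a := Ψ y - v) (by linarith)]
          have hyu : u ≤ Φ y := by
            by_contra! hcon
            linarith [hsep y (by linarith)]
          -- A geodesic across the plateau meets a point `z` with `Φ z ≥ u` and `Ψ z` below `v` by
          -- `1 + 2 * C + K`; this margin pays for the extra `K` and the detour `2 * C`.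
          obtain ⟨c, c1, c2, c3⟩ := hgeo x y
          obtain ⟨z, z1, z2, z3⟩ := exists_crossing c1 c2 c3 hΦ hxu hyu
          have hz := hsep z (by linarith)
          have h5 := (le_abs_self _).trans (hΦ.1 z x)
          have h6 := (le_abs_self _).trans (hΨ.1 y z)
          rw [dist_comm z x] at h5
          rw [dist_comm y z] at h6
          linarith [min_le_right (Φ y) u]
    intro x y
    rw [abs_le]
    have h1 := key x y
    have h2 := key y x
    rw [dist_comm y x] at h2
    constructor <;> linarith
  · intro a b c
    have hmed : realMedian (min (Φ a) u + max (Ψ a - v) 0) (min (Φ b) u + max (Ψ b - v) 0)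
        (min (Φ c) u + max (Ψ c - v) 0) =
        min (realMedian (Φ a) (Φ b) (Φ c)) u + max (realMedian (Ψ a) (Ψ b) (Ψ c) - v) 0 := by
      -- Both summands are monotone functions of the glued value, so real medians can be taken
      -- before or after gluing.
      have e1 : ∀ x, min (min (Φ x) u + max (Ψ x - v) 0) u = min (Φ x) u ∧
          max (min (Φ x) u + max (Ψ x - v) 0 - u) 0 = max (Ψ x - v) 0 := by
        intro x
        rcases le_or_gt (Φ x) u with hx | hx
        · have := hsep x (by linarith)
          rw [min_eq_left hx, max_eq_right (a := Ψ x - v) (by linarith), add_zero]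
          exact ⟨min_eq_left hx, max_eq_right (by linarith)⟩
        · rw [min_eq_right hx.le]
          have := le_max_right (Ψ x - v) 0
          refine ⟨min_eq_right (by linarith), ?_⟩
          rw [add_sub_cancel_left, max_eq_left this]
      have e2 : Monotone fun t : ℝ => min t u := fun s t h => min_le_min_right _ h
      have e3 : Monotone fun t : ℝ => max (t - u) 0 := fun s t h =>
        max_le_max_right _ (sub_le_sub_right h u)
      have e4 : Monotone fun t : ℝ => max (t - v) 0 := fun s t h =>
        max_le_max_right _ (sub_le_sub_right h v)
      rw [map_realMedian e2, map_realMedian e4]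
      rw [← (e1 a).1, ← (e1 b).1, ← (e1 c).1, ← (e1 a).2, ← (e1 b).2, ← (e1 c).2]
      rw [← map_realMedian e2, ← map_realMedian e3]
      simp only [(e1 a).1, (e1 b).1, (e1 c).1, (e1 a).2, (e1 b).2, (e1 c).2]
      set t := realMedian (min (Φ a) u + max (Ψ a - v) 0) (min (Φ b) u + max (Ψ b - v) 0)
        (min (Φ c) u + max (Ψ c - v) 0)
      rcases le_total t u with h | h
      · rw [min_eq_left h, max_eq_right (by linarith), add_zero]
      · rw [min_eq_right h, max_eq_left (by linarith)]
        ring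
    beta_reduce
    rw [hmed]
    have h1 := hΦ.2 a b c
    have h2 := hΨ.2 a b c
    set m := μ a b c
    -- On either side of the threshold one summand contributes no error, so the errors of `Φ` and
    -- `Ψ` never add up.
    rcases le_or_gt (Φ m) (u + (1 + 2 * C + K)) with hm | hm
    · have h3 := hsep m hm
      have h4 := (abs_le.1 h2).1
      rw [max_eq_right (a := Ψ m - v) (by linarith),
        max_eq_right (a := realMedian (Ψ a) (Ψ b) (Ψ c) - v) (by linarith)]
      simp only [add_zero]
      exact (abs_min_sub_min_le_max _ _ _ _).trans (by simpa using h1)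
    · have h4 := (abs_le.1 h1).2
      rw [min_eq_right (a := Φ m) (by linarith),
        min_eq_right (a := realMedian (Φ a) (Φ b) (Φ c)) (by linarith), add_sub_add_left_eq_sub]
      exact (abs_max_sub_max_le_max _ _ _ _).trans (by simpa using h2)

/-- If the sublevel sets were disjoint, gluing `Φ` to `-Ψ` at levels `r + 1` and `-s` would give an
increase of `r + s + 1 > σ(a,b)`. -/
theorem exists_mem_sublevels (hK : 0 ≤ K) {C : ℝ} (hC : 0 ≤ C)
    (hgeo : ∀ a b : X, ∃ f : ℝ → X, f 0 = a ∧ f (dist a b) = b ∧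
      ∀ s ∈ Set.Icc (0 : ℝ) (dist a b), ∀ t ∈ Set.Icc (0 : ℝ) (dist a b),
        dist (f s) (f t) ≤ |s - t| + C)
    {a b : X} {r s : ℝ} (hr : 0 ≤ r) (hs : 0 ≤ s) (hrs : sigma μ K a b ≤ r + s)
    {Φ Ψ : X → ℝ} (hΦ : IsContraction μ K Φ) (hΨ : IsContraction μ K Ψ) (ha : Φ a = 0)
    (hb : Ψ b = 0) :
    ∃ x, Φ x ≤ r + (2 + 2 * C + K) ∧ Ψ x ≤ s + (2 + 2 * C + K) := by
  by_contra! hcon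
  have hglue := IsContraction.glue hK hC hgeo hΦ hΨ.neg (u := r + 1) (v := -s)
    (fun x hx => by linarith [hcon x (by linarith)])
  have h1 := sub_le_sigma hK hglue a b
  have h2 := hcon a (by linarith)
  have h3 : r + (2 + 2 * C + K) < Φ b := by
    by_contra! h
    linarith [hcon b h]
  simp only [ha, hb] at h1
  rw [min_eq_right (a := Φ b) (by linarith), min_eq_left (a := (0 : ℝ)) (by linarith),
    max_eq_left (a := -0 - -s) (by linarith), max_eq_right (a := -Ψ a - -s) (by linarith)] at h1
  linarith

/-! ### Interpolation for `σ` -/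

theorem exists_interpolation (hQ : HasQuasicubicalIntervals μ)
    (hd : IsRoughlyGeodesic (fun x y : X => dist x y)) (hK : 0 ≤ K) :
    ∃ G : ℝ, 0 ≤ G ∧ ∀ (a b : X) (r s : ℝ), 0 ≤ r → 0 ≤ s → sigma μ K a b ≤ r + s →
      ∃ c, sigma μ K a c ≤ r + G ∧ sigma μ K c b ≤ s + G := by
  obtain ⟨ν, -, κ, hκ, hQ⟩ := hQ
  obtain ⟨C, hC, hgeo⟩ := hd
  have hgeo' : ∀ a b : X, ∃ f : ℝ → X, f 0 = a ∧ f (dist a b) = b ∧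
      ∀ s ∈ Set.Icc (0 : ℝ) (dist a b), ∀ t ∈ Set.Icc (0 : ℝ) (dist a b),
        dist (f s) (f t) ≤ |s - t| + C := fun a b => by
    obtain ⟨f, f1, f2, f3⟩ := hgeo a b
    exact ⟨f, f1, f2, fun s hs t ht => (f3 s hs t ht).2⟩
  have hν : (0 : ℝ) ≤ ν := Nat.cast_nonneg ν
  set G₁ : ℝ := 2 + 2 * C + K + (κ + 2 * K) with hG₁
  have hG₁' : 0 ≤ G₁ := by linarith
  refine ⟨G₁ + ν * (κ + 2 * K), by positivity, fun a b r s hr hs hrs => ?_⟩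
  obtain ⟨Q, lam, hdim, -, hdense, -, hmed⟩ := hQ a b
  -- The defect is `κ` for `λ`, and one `K` for each of the two contraction axioms.
  have hquasi : ∀ Φ : X → ℝ, IsContraction μ K Φ → ∀ x y z,
      Φ (lam (Q.median x y z)) ≤ max (Φ (lam x)) (Φ (lam y)) + (κ + 2 * K) := by
    intro Φ hΦ x y z
    have h1 := (le_abs_self _).trans
      (hΦ.1 (lam (Q.median x y z)) (μ (lam x) (lam y) (lam z)))
    have h2 := (le_abs_self _).trans (hΦ.2 (lam x) (lam y) (lam z))
    have h3 := hmed x y z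
    have h4 := realMedian_le_max (Φ (lam x)) (Φ (lam y)) (Φ (lam z))
    linarith
  -- A projection to the cubical model. As `Φ a = 0` or `Φ b = 0`, it preserves nonnegative
  -- sublevels of `Φ` up to a constant.
  choose g hg using fun x : X => hdense (μ a b x) ⟨x, rfl⟩
  have hproj : ∀ Φ : X → ℝ, IsContraction μ K Φ → ∀ x,
      Φ (lam (g x)) ≤ realMedian (Φ a) (Φ b) (Φ x) + (κ + 2 * K) := by
    intro Φ hΦ x
    have h1 := (le_abs_self _).trans (hΦ.1 (lam (g x)) (μ a b x))
    have h2 := (le_abs_self _).trans (hΦ.2 a b x)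
    have h3 := hg x
    linarith
  let S : (X → ℝ) → ℝ → Set Q.V := fun Φ t => Q.hull {α | Φ (lam α) ≤ t}
  have hSa : ∀ Φ, IsContraction μ K Φ → Φ a = 0 → ∀ x, Φ x ≤ r + (2 + 2 * C + K) →
      g x ∈ S Φ (r + G₁) := by
    intro Φ hΦ h0 x hx
    apply FiniteCAT0CubeComplex.subset_hull
    have h1 := hproj Φ hΦ x
    rw [h0] at h1
    have h2 : max 0 (Φ x) ≤ r + (2 + 2 * C + K) := max_le (by linarith) hx
    have h3 := realMedian_le_max_zero (b := Φ b) (c := Φ x)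
    change Φ (lam (g x)) ≤ r + G₁
    linarith
  have hSb : ∀ Φ, IsContraction μ K Φ → Φ b = 0 → ∀ x, Φ x ≤ s + (2 + 2 * C + K) →
      g x ∈ S Φ (s + G₁) := by
    intro Φ hΦ h0 x hx
    apply FiniteCAT0CubeComplex.subset_hull
    have h1 := hproj Φ hΦ x
    rw [h0] at h1
    have h2 : max 0 (Φ x) ≤ s + (2 + 2 * C + K) := max_le (by linarith) hx
    have h3 := realMedian_le_max_zero' (b := Φ a) (c := Φ x)
    change Φ (lam (g x)) ≤ s + G₁
    linarith
  have hSab : ∀ Φ Ψ, IsContraction μ K Φ → IsContraction μ K Ψ → Φ a = 0 → Ψ b = 0 →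
      (S Φ (r + G₁) ∩ S Ψ (s + G₁)).Nonempty := by
    intro Φ Ψ hΦ hΨ ha hb
    obtain ⟨x, hx1, hx2⟩ := exists_mem_sublevels hK hC hgeo' hr hs hrs hΦ hΨ ha hb
    exact ⟨g x, hSa Φ hΦ ha x hx1, hSb Ψ hΨ hb x hx2⟩
  obtain ⟨α, hα⟩ := FiniteCAT0CubeComplex.helly_sUnion (Q := Q)
    {A | (∃ Φ, IsContraction μ K Φ ∧ Φ a = 0 ∧ A = S Φ (r + G₁)) ∨
      ∃ Φ, IsContraction μ K Φ ∧ Φ b = 0 ∧ A = S Φ (s + G₁)}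
    (by
      rintro A (⟨Φ, -, -, rfl⟩ | ⟨Φ, -, -, rfl⟩) <;>
        exact FiniteCAT0CubeComplex.isConvex_hull _)
    (by
      rintro A (⟨Φ, hΦ, ha, rfl⟩ | ⟨Φ, hΦ, hb, rfl⟩) B (⟨Ψ, hΨ, ha', rfl⟩ | ⟨Ψ, hΨ, hb', rfl⟩)
      · exact ⟨g a, hSa Φ hΦ ha a (by linarith), hSa Ψ hΨ ha' a (by linarith)⟩
      · exact hSab Φ Ψ hΦ hΨ ha hb'
      · rw [Set.inter_comm]
        exact hSab Ψ Φ hΨ hΦ ha' hb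
      · exact ⟨g b, hSb Φ hΦ hb b (by linarith), hSb Ψ hΨ hb' b (by linarith)⟩)
  have hk : 0 ≤ κ + 2 * K := by linarith
  refine ⟨lam α, sigma_le hK fun Φ hΦ => ?_, ?_⟩
  · have := FiniteCAT0CubeComplex.le_of_mem_hull hdim hk
      (hquasi _ (hΦ.add_const (-Φ a))) (hα _ (Or.inl ⟨_, hΦ.add_const (-Φ a), by ring, rfl⟩))
    linarith
  · rw [sigma_comm hK]
    refine sigma_le hK fun Φ hΦ => ?_
    have := FiniteCAT0CubeComplex.le_of_mem_hull hdim hk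
      (hquasi _ (hΦ.add_const (-Φ b))) (hα _ (Or.inr ⟨_, hΦ.add_const (-Φ b), by ring, rfl⟩))
    linarith

theorem isWeaklyRoughlyGeodesic_sigma (hQ : HasQuasicubicalIntervals μ)
    (hd : IsRoughlyGeodesic (fun x y : X => dist x y)) (hK : 0 ≤ K) :
    IsWeaklyRoughlyGeodesic (sigma μ K) := by
  obtain ⟨G, hG, h⟩ := exists_interpolation hQ hd hK
  refine ⟨2 * G, by linarith, fun a b r hr hrD => ?_⟩
  obtain ⟨c, h1, h2⟩ := h a b r (sigma μ K a b - r) hr (by linarith) (by linarith)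
  have h3 := sigma_triangle (μ := μ) hK a c b
  refine ⟨c, ?_, by linarith⟩
  rw [abs_le]
  constructor <;> linarith

/-! ### Comparison of `σ` with the original metric -/

/-- The axiom distributes over two arguments only; idempotence of `m a b` allows a second
application, which reaches the third. -/
theorem IsMedian.median_median {Q : Type*} {m : Q → Q → Q → Q} (hm : IsMedian m)
    (a b x y z : Q) : m a b (m x y z) = m (m a b x) (m a b y) (m a b z) := by
  have h1 : m a b a = a := by
    rw [hm.swap_right, hm.localised]
  have h2 : m a b b = b := by
    rw [hm.swap_left, hm.swap_right, hm.localised]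
  have idem : ∀ w, m a b (m a b w) = m a b w := fun w => by
    rw [hm.assoc, h1, h2]
  have rot : ∀ u v w, m u v w = m w u v := fun u v w => by
    rw [hm.swap_right, hm.swap_left]
  calc m a b (m x y z) = m a b (m a b (m x y z)) := (idem _).symm
    _ = m a b (m (m a b x) (m a b y) z) := by rw [← hm.assoc]
    _ = m a b (m z (m a b x) (m a b y)) := by rw [rot _ _ z]
    _ = m (m a b z) (m a b x) (m a b y) := by rw [hm.assoc, idem]
    _ = m (m a b x) (m a b y) (m a b z) := (rot _ _ _).symm

/-- The five-point consequences of the axioms of coarse median spaces. -/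
theorem IsCoarseMedian.exists_bound (hμ : IsCoarseMedian μ) :
    ∃ L H : ℝ, 0 ≤ L ∧ 0 ≤ H ∧
      (∀ a b c a' b' c' : X,
        dist (μ a b c) (μ a' b' c') ≤ H * (dist a a' + dist b b' + dist c c') + H) ∧
      (∀ a b : X, dist a (μ a b a) ≤ L ∧ dist b (μ a b b) ≤ L) ∧
      ∀ a b x y z : X,
        dist (μ a b (μ x y z)) (μ (μ a b x) (μ a b y) (μ a b z)) ≤ L := by
  classical
  obtain ⟨h, hpos, hlip, happ⟩ := hμ
  have h0 := hpos 0
  have h5 := hpos 5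
  set r : ℝ := h 0 * (3 * h 5) + h 0 + h 5 + h 5 with hr
  have hr5 : h 5 ≤ r := by
    have : 0 ≤ h 0 * (3 * h 5) := by positivity
    linarith
  refine ⟨2 * (h 0 * (3 * r) + h 0 + h 5) + (r + h 5), h 0, by positivity, h0.le, hlip, ?_⟩
  have main : ∀ a b x y z : X,
      (dist a (μ a b a) ≤ r + h 5 ∧ dist b (μ a b b) ≤ r + h 5) ∧
      dist (μ a b (μ x y z)) (μ (μ a b x) (μ a b y) (μ a b z)) ≤
        2 * (h 0 * (3 * r) + h 0 + h 5) := by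
    intro a b x y z
    obtain ⟨Q, -, m, pr, lam, hm, -, hlam, hA⟩ := happ 5 {a, b, x, y, z} ⟨a, by simp⟩
      Finset.card_le_five
    have approx : ∀ (e : ℝ) (u v w : X) (α β γ : Q), dist u (lam α) ≤ e → dist v (lam β) ≤ e →
        dist w (lam γ) ≤ e → dist (μ u v w) (lam (m α β γ)) ≤ h 0 * (3 * e) + h 0 + h 5 := by
      intro e u v w α β γ h1 h2 h3
      have e1 := hlip u v w (lam α) (lam β) (lam γ)
      have e2 := hlam α β γ
      rw [dist_comm] at e2
      have e3 := dist_triangle (μ u v w) (μ (lam α) (lam β) (lam γ)) (lam (m α β γ))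
      have e4 : h 0 * (dist u (lam α) + dist v (lam β) + dist w (lam γ)) ≤ h 0 * (3 * e) := by
        apply mul_le_mul_of_nonneg_left _ h0.le
        linarith
      linarith
    obtain ⟨α, hα⟩ : ∃ α, dist a (lam α) ≤ h 5 := ⟨_, hA ⟨a, by simp⟩⟩
    obtain ⟨β, hβ⟩ : ∃ α, dist b (lam α) ≤ h 5 := ⟨_, hA ⟨b, by simp⟩⟩
    obtain ⟨ξ, hξ⟩ : ∃ α, dist x (lam α) ≤ h 5 := ⟨_, hA ⟨x, by simp⟩⟩
    obtain ⟨η, hη⟩ : ∃ α, dist y (lam α) ≤ h 5 := ⟨_, hA ⟨y, by simp⟩⟩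
    obtain ⟨ζ, hζ⟩ : ∃ α, dist z (lam α) ≤ h 5 := ⟨_, hA ⟨z, by simp⟩⟩
    have approx' : ∀ (u v w : X) (α β γ : Q), dist u (lam α) ≤ h 5 → dist v (lam β) ≤ h 5 →
        dist w (lam γ) ≤ h 5 → dist (μ u v w) (lam (m α β γ)) ≤ r := by
      intro u v w α β γ h1 h2 h3
      have := approx _ u v w α β γ h1 h2 h3
      linarith
    refine ⟨⟨?_, ?_⟩, ?_⟩
    · have e1 := approx' a b a α β α hα hβ hα
      rw [hm.swap_right, hm.localised] at e1
      have e2 := dist_triangle_right a (μ a b a) (lam α)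
      linarith
    · have e1 := approx' a b b α β β hα hβ hβ
      rw [hm.swap_left, hm.swap_right, hm.localised] at e1
      have e2 := dist_triangle_right b (μ a b b) (lam β)
      linarith
    · have e1 := approx r a b (μ x y z) α β (m ξ η ζ) (hα.trans hr5) (hβ.trans hr5)
        (approx' _ _ _ _ _ _ hξ hη hζ)
      have e2 := approx r (μ a b x) (μ a b y) (μ a b z) (m α β ξ) (m α β η) (m α β ζ)
        (approx' _ _ _ _ _ _ hα hβ hξ) (approx' _ _ _ _ _ _ hα hβ hη)
        (approx' _ _ _ _ _ _ hα hβ hζ)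
      rw [hm.median_median] at e1
      have e3 := dist_triangle_right (μ a b (μ x y z)) (μ (μ a b x) (μ a b y) (μ a b z))
        (lam (m (m α β ξ) (m α β η) (m α β ζ)))
      linarith
  have hp : 0 ≤ h 0 * (3 * r) + h 0 + h 5 := by positivity
  exact ⟨fun a b => ⟨(main a b a a a).1.1.trans (by linarith),
    (main a b a a a).1.2.trans (by linarith)⟩,
    fun a b x y z => (main a b x y z).2.trans (by linarith)⟩

/-- Quasi-median coarsely Lipschitz functions detect the metric up to quasi-isometry. -/
theorem exists_quasimedian_function (hμ : IsCoarseMedian μ) (hQ : HasQuasicubicalIntervals μ) :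
    ∃ L : ℝ, 1 ≤ L ∧ ∀ a b : X, ∃ Φ : X → ℝ,
      (∀ x y, |Φ x - Φ y| ≤ L * dist x y + L) ∧
      (∀ x y z, |Φ (μ x y z) - realMedian (Φ x) (Φ y) (Φ z)| ≤ L) ∧
      dist a b ≤ L * (Φ b - Φ a) + L := by
  obtain ⟨L, H, hL, hH, hlip, hend, hfive⟩ := hμ.exists_bound
  obtain ⟨ν, -, κ, hκ, hQ⟩ := hQ
  have hκ0 : 0 ≤ κ := by linarith
  have hν : (0 : ℝ) ≤ ν := Nat.cast_nonneg ν
  -- `L₁`, `L₂` bound the Lipschitz behaviour, `L₃` the median defect, and `L₄`, `L₅` the comparison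
  -- with `d`.
  set L₁ : ℝ := κ * H with hL₁
  set L₂ : ℝ := κ * (3 * κ + H) with hL₂
  set L₃ : ℝ := κ * (3 * κ + (H * (3 * κ) + H) + L) with hL₃
  set L₄ : ℝ := κ * (ν + 1) with hL₄
  set L₅ : ℝ := 2 * (L + κ) + κ with hL₅
  have p1 : 0 ≤ L₁ := by positivity
  have p2 : 0 ≤ L₂ := by positivity
  have p3 : 0 ≤ L₃ := by positivity
  have p4 : 0 ≤ L₄ := by positivity
  have p5 : 0 ≤ L₅ := by positivity
  refine ⟨1 + L₁ + L₂ + L₃ + L₄ + L₅, by linarith, fun a b => ?_⟩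
  obtain ⟨Q, lam, hdim, -, hdense, hqi, hmed⟩ := hQ a b
  have hlow : ∀ α β, (Q.graph.dist α β : ℝ) ≤ κ * (dist (lam α) (lam β) + κ) := by
    intro α β
    have h1 := (hqi α β).1
    have h2 : 1 / κ * Q.l1dist α β ≤ dist (lam α) (lam β) + κ := by linarith
    rw [one_div, inv_mul_le_iff₀ (by linarith)] at h2
    exact h2
  choose g hg using fun x : X => hdense (μ a b x) ⟨x, rfl⟩
  obtain ⟨f, f0, fab, fmed, flip⟩ :=
    FiniteCAT0CubeComplex.exists_contracting_map hdim (g a) (g b)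
  have flip' : ∀ u v, |(f u : ℝ) - f v| ≤ Q.graph.dist u v := by
    intro u v
    have h1 : (f u : ℝ) ≤ f v + Q.graph.dist u v := by exact_mod_cast flip u v
    have h2 : (f v : ℝ) ≤ f u + Q.graph.dist u v := by
      rw [Q.dist_comm u v]
      exact_mod_cast flip v u
    rw [abs_le]
    constructor <;> linarith
  refine ⟨fun x => f (g x), fun x y => ?_, fun x y z => ?_, ?_⟩
  · have h1 := flip' (g x) (g y)
    have h2 := hlow (g x) (g y)
    have h3 := hlip a b x a b y
    rw [dist_self, dist_self, zero_add, zero_add] at h3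
    have h4 := dist_triangle4 (lam (g x)) (μ a b x) (μ a b y) (lam (g y))
    have h5 := hg x
    have h6 := hg y
    rw [dist_comm] at h6
    have h7 : κ * (dist (lam (g x)) (lam (g y)) + κ) ≤ κ * ((3 * κ + H) + H * dist x y) := by
      apply mul_le_mul_of_nonneg_left _ hκ0
      linarith
    have h8 : κ * ((3 * κ + H) + H * dist x y) = L₁ * dist x y + L₂ := by
      rw [hL₁, hL₂]
      ring
    have h9 : 0 ≤ (1 + L₂ + L₃ + L₄ + L₅) * dist x y := by positivity
    linarith
  · rw [← fmed]
    refine (flip' _ _).trans ((hlow _ _).trans ?_)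
    have h1 := hg (μ x y z)
    have h2 := hfive a b x y z
    have h3 := hlip (μ a b x) (μ a b y) (μ a b z) (lam (g x)) (lam (g y)) (lam (g z))
    have h4 := hmed (g x) (g y) (g z)
    have h5 := hg x
    have h6 := hg y
    have h7 := hg z
    rw [dist_comm] at h4 h5 h6 h7
    have h8 : H * (dist (μ a b x) (lam (g x)) + dist (μ a b y) (lam (g y)) +
        dist (μ a b z) (lam (g z))) ≤ H * (3 * κ) := by
      apply mul_le_mul_of_nonneg_left _ hH
      linarith
    have t1 := dist_triangle4 (lam (g (μ x y z))) (μ a b (μ x y z))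
      (μ (μ a b x) (μ a b y) (μ a b z)) (μ (lam (g x)) (lam (g y)) (lam (g z)))
    have t2 := dist_triangle (lam (g (μ x y z))) (μ (lam (g x)) (lam (g y)) (lam (g z)))
      (lam (Q.median (g x) (g y) (g z)))
    have h9 : κ * (dist (lam (g (μ x y z))) (lam (Q.median (g x) (g y) (g z))) + κ) ≤ L₃ := by
      apply mul_le_mul_of_nonneg_left _ hκ0
      linarith
    linarith
  · have h1 := (hend a b).1
    have h2 := (hend a b).2
    have h3 := hg a
    have h4 := hg b
    rw [dist_comm] at h3
    have h5 := (hqi (g a) (g b)).2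
    have t1 := dist_triangle4 a (μ a b a) (lam (g a)) (lam (g b))
    have t2 := dist_triangle4 a (lam (g b)) (μ a b b) b
    rw [dist_comm] at h2
    have h6 : (Q.graph.dist (g a) (g b) : ℝ) ≤ (ν + 1) * f (g b) := by exact_mod_cast fab
    have h7 : κ * Q.l1dist (g a) (g b) ≤ κ * ((ν + 1) * f (g b)) :=
      mul_le_mul_of_nonneg_left h6 hκ0
    have h8 : κ * ((ν + 1) * f (g b)) = L₄ * f (g b) := by
      rw [hL₄]
      ring
    simp only [f0, Nat.cast_zero, sub_zero]
    have h9 : 0 ≤ (1 + L₁ + L₂ + L₃ + L₅) * (f (g b) : ℝ) := by positivity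
    linarith

theorem areQuasiIsometric_sigma (hμ : IsCoarseMedian μ) (hQ : HasQuasicubicalIntervals μ)
    (hK : 0 < K) : AreQuasiIsometric (fun x y : X => dist x y) (sigma μ K) := by
  obtain ⟨L, hL, h⟩ := exists_quasimedian_function hμ hQ
  have hL0 : 0 < L := by linarith
  -- This scale makes the slope at most `1` and both additive errors at most `K`.
  set s : ℝ := min 1 K / L with hs
  have hs0 : 0 < s := div_pos (lt_min one_pos hK) hL0
  have hsL : s * L = min 1 K := div_mul_cancel₀ _ hL0.ne'
  have hs1 : s * L ≤ 1 := hsL.trans_le (min_le_left _ _)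
  have hsK : s * L ≤ K := hsL.trans_le (min_le_right _ _)
  set q : ℝ := 1 + K + L / s with hq
  have hLs : 0 < L / s := div_pos hL0 hs0
  have hq1 : 1 ≤ q := by linarith
  refine ⟨q, hq1, fun x y => ⟨?_, ?_⟩⟩
  · obtain ⟨Φ, h1, h2, h3⟩ := h x y
    have hmono : Monotone fun t : ℝ => s * t := fun _ _ hab => mul_le_mul_of_nonneg_left hab hs0.le
    have hΦ : IsContraction μ K (fun z => s * Φ z) := by
      refine ⟨fun u v => ?_, fun a b c => ?_⟩
      · rw [← mul_sub, abs_mul, abs_of_pos hs0]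
        have e1 := mul_le_mul_of_nonneg_left (h1 u v) hs0.le
        have e2 := mul_le_mul_of_nonneg_right hs1 (dist_nonneg (x := u) (y := v))
        linarith
      · rw [← map_realMedian hmono, ← mul_sub, abs_mul, abs_of_pos hs0]
        exact (mul_le_mul_of_nonneg_left (h2 a b c) hs0.le).trans hsK
    have e1 := sub_le_sigma hK.le hΦ x y
    have e2 : 1 / q * dist x y ≤ s / L * dist x y := by
      apply mul_le_mul_of_nonneg_right _ dist_nonneg
      rw [one_div, ← inv_div]
      exact inv_anti₀ hLs (by linarith)
    have e3 : s / L * dist x y ≤ s / L * (L * (Φ y - Φ x) + L) :=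
      mul_le_mul_of_nonneg_left h3 (div_pos hs0 hL0).le
    have e4 : s / L * (L * (Φ y - Φ x) + L) = s * Φ y - s * Φ x + s := by
      field_simp
    have e5 : s ≤ 1 := by
      have : s * 1 ≤ s * L := mul_le_mul_of_nonneg_left hL hs0.le
      linarith
    simp only at *
    linarith
  · have h1 := sigma_le_dist_add (μ := μ) hK.le x y
    have h2 := mul_le_mul_of_nonneg_right hq1 (dist_nonneg (x := x) (y := y))
    simp only
    linarith

/-! ### Balls for `σ` -/

/-- A real median is at most the larger of any two of its arguments, so `x` plays no role. -/
theorem sigma_median_le (hK : 0 ≤ K) {w x y y' : X} {R : ℝ} (hy : sigma μ K w y ≤ R)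
    (hy' : sigma μ K w y' ≤ R) : sigma μ K w (μ x y y') ≤ R + K := by
  refine sigma_le hK fun Φ hΦ => ?_
  have h1 := (sub_le_sigma hK hΦ w y).trans hy
  have h2 := (sub_le_sigma hK hΦ w y').trans hy'
  have h3 := (abs_le.1 (hΦ.2 x y y')).2
  have h4 : realMedian (Φ x) (Φ y) (Φ y') ≤ max (Φ y) (Φ y') := by
    simp only [realMedian, max_def, min_def]
    split_ifs <;> linarith
  have h5 : max (Φ y) (Φ y') ≤ R + Φ w := max_le (by linarith) (by linarith)
  linarith

theorem exists_sigma_lt (hQ : HasQuasicubicalIntervals μ)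
    (hd : IsRoughlyGeodesic (fun x y : X => dist x y)) (hK : 0 ≤ K) :
    ∃ M : ℝ, 0 ≤ M ∧ ∀ (w p : X) (R : ℝ), sigma μ K w p ≤ R + K →
      sigma μ K w p ≤ M ∨ ∃ z, sigma μ K w z < R ∧ sigma μ K z p ≤ M := by
  obtain ⟨G, hG, h⟩ := exists_interpolation hQ hd hK
  refine ⟨K + G + 1 + G, by linarith, fun w p R hR => ?_⟩
  rcases le_total (sigma μ K w p) (K + G + 1) with hle | hge
  · exact Or.inl (by linarith)
  -- Stopping `K + G + 1` short of `p` absorbs the excess `K` and the error `G`, and leaves `1` for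
  -- the strict inequality that open balls need.
  · obtain ⟨z, h1, h2⟩ := h w p (sigma μ K w p - (K + G + 1)) (K + G + 1) (by linarith)
      (by linarith) (by linarith)
    exact Or.inr ⟨z, by linarith, h2⟩

theorem exists_isCoarselyMedianConvex_ball (hμ : IsCoarseMedian μ)
    (hQ : HasQuasicubicalIntervals μ) (hd : IsRoughlyGeodesic (fun x y : X => dist x y))
    (hK : 0 < K) :
    ∃ M : ℝ, 0 ≤ M ∧ ∀ (w : X) (R : ℝ),
      ∀ B : Set X, (B = closedBall (sigma μ K) w R ∨ B = openBall (sigma μ K) w R) →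
      IsCoarselyMedianConvex μ (fun x y : X => dist x y) M B ∧
      IsCoarselyMedianConvex μ (sigma μ K) M B := by
  obtain ⟨M, hM, h⟩ := exists_sigma_lt hQ hd hK.le
  obtain ⟨q, hq, hqi⟩ := areQuasiIsometric_sigma hμ hQ hK
  have hq0 : 0 < q := by linarith
  have hle : M ≤ q * (M + q) := by nlinarith
  refine ⟨q * (M + q), by positivity, fun w R B hB => ?_⟩
  have hsub : ∀ z, sigma μ K w z < R → z ∈ B := by
    rcases hB with rfl | rfl
    · exact fun z hz => hz.le
    · exact fun z hz => hz
  have hsup : ∀ z ∈ B, sigma μ K w z ≤ R := by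
    rcases hB with rfl | rfl
    · exact fun z hz => hz
    · exact fun z hz => le_of_lt hz
  -- A nonempty ball contains its centre, which serves as the nearby point when the median is close
  -- to `w`.
  have hw : ∀ z ∈ B, w ∈ B := by
    have hself := sigma_self (μ := μ) hK.le w
    rcases hB with rfl | rfl
    · exact fun z hz => (hself.trans_le (sigma_nonneg hK.le w z)).trans hz
    · exact fun z hz => (hself.trans_le (sigma_nonneg hK.le w z)).trans_lt hz
  have key : ∀ y ∈ B, ∀ y' ∈ B, ∀ x, ∃ z ∈ B, sigma μ K z (μ x y y') ≤ M := by
    intro y hy y' hy' x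
    rcases h w (μ x y y') R (sigma_median_le hK.le (hsup y hy) (hsup y' hy')) with h1 | ⟨z, h1, h2⟩
    · exact ⟨w, hw y hy, h1⟩
    · exact ⟨z, hsub z h1, h2⟩
  constructor
  · intro y hy y' hy' x
    obtain ⟨z, hz, hzM⟩ := key y hy y' hy' x
    refine (ciInf_le ⟨0, ?_⟩ (⟨z, hz⟩ : B)).trans ?_
    · rintro _ ⟨z, rfl⟩
      exact dist_nonneg
    · have h1 := (hqi z (μ x y y')).1
      have h2 : 1 / q * dist z (μ x y y') ≤ M + q := by
        simp only at h1
        linarith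
      rwa [one_div, inv_mul_le_iff₀ hq0] at h2
  · intro y hy y' hy' x
    obtain ⟨z, hz, hzM⟩ := key y hy y' hy' x
    refine (ciInf_le ⟨0, ?_⟩ (⟨z, hz⟩ : B)).trans (hzM.trans hle)
    rintro _ ⟨z, rfl⟩
    exact sigma_nonneg hK.le _ _

end CoarseMedian

theorem mainTheorem4 {X : Type*} [MetricSpace X] (μ : X → X → X → X)
    (hμ : CoarseMedian.IsCoarseMedian μ)
    (hQ : CoarseMedian.HasQuasicubicalIntervals μ)
    (hd : CoarseMedian.IsRoughlyGeodesic (fun x y : X => dist x y))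
    (K : ℝ) (hK : 0 < K) :
    CoarseMedian.IsMetric (CoarseMedian.sigma μ K) ∧
    CoarseMedian.AreQuasiIsometric (fun x y : X => dist x y) (CoarseMedian.sigma μ K) ∧
    CoarseMedian.IsWeaklyRoughlyGeodesic (CoarseMedian.sigma μ K) ∧
    (∃ M : ℝ, 0 ≤ M ∧ ∀ (w : X) (R : ℝ),
      ∀ B : Set X, (B = CoarseMedian.closedBall (CoarseMedian.sigma μ K) w R ∨
        B = CoarseMedian.openBall (CoarseMedian.sigma μ K) w R) →
      CoarseMedian.IsCoarselyMedianConvex μ (fun x y : X => dist x y) M B ∧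
      CoarseMedian.IsCoarselyMedianConvex μ (CoarseMedian.sigma μ K) M B) ∧
    ∀ g : X ≃ᵢ X, (∀ x y z : X, g (μ x y z) = μ (g x) (g y) (g z)) →
      ∀ x y : X, CoarseMedian.sigma μ K (g x) (g y) = CoarseMedian.sigma μ K x y :=
  ⟨CoarseMedian.isMetric_sigma hK, CoarseMedian.areQuasiIsometric_sigma hμ hQ hK,
    CoarseMedian.isWeaklyRoughlyGeodesic_sigma hQ hd hK.le,
    CoarseMedian.exists_isCoarselyMedianConvex_ball hμ hQ hd hK,
    fun g hg => CoarseMedian.sigma_equivariant hK.le g hg⟩
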